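/- Let $1\le N\le 4$, let $\Omega\subset\mathbb{R}^N$ be a bounded domain (nonempty, open, connected), and let $m\in\mathbb N$ and $\varepsilon_1,\dots,\varepsilon_m>0$. Let $H=H_0^1(\Omega,\mathbb{R}^m)$, i.e. each component lies in the closure of $C_c^\infty(\Omega)$ in $H^1(\Omega)$, and put $$\|\mathbf u\|_H=\Big(\int_\Omega\sum_{i=1}^m\varepsilon_i|\nabla u_i|^2\,dx\Big)^{1/2}.$$ Let $\lambda_1=\inf\{\int_\Omega|\nabla u|^2dx: u\in H_0^1(\Omega),\ \int_\Omega u^2dx=1\}$ be the first Dirichlet eigenvalue of $-\Delta$ in $\Omega$. Let $g=(g_{ij})\in\mathbb{R}^{m\times m}$ be symmetric and assume that either $g_{ij}>0$ for all $i,j$, or $g$ is positive definite. Let $a_1,\dots,a_m\in L^\infty(\Omega)$ satisfy $a_i(x)>-\varepsilon_i\lambda_1$ for a.e. $x\in\Omega$ and all $i$. Define, for $\mathbf u\in H$, $$K(\mathbf u)=\int_\Omega\sum_{i=1}^m\big(\varepsilon_i|\nabla u_i|^2+a_iu_i^2\big)dx,\qquad I(\mathbf u)=\int_\Omega\sum_{i,j=1}^m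 g_{ij}u_i^2u_j^2\,dx,\qquad E(\mathbf u)=\tfrac12K(\mathbf u)-\tfrac14I(\mathbf u),$$ let $\mathcal N=\{\mathbf u\in H\setminus\{0\}:\langle E'(\mathbf u),\mathbf u\rangle=0\}$ be the Nehari manifold, where $E'$ is the Fréchet derivative of $E$, and for $\mathbf v\in H\setminus\{0\}$ let $\rho(\mathbf v)=(K(\mathbf v)/I(\mathbf v))^{1/2}$. For $\mathbf u,\bar{\mathbf u}\in\mathcal N$ and $t\in[0,1]$ put $\hat{\mathbf w}=\mathbf u+t(\mathbf u-\bar{\mathbf u})$. Then: (i) $\hat{\mathbf w}\neq0$, and $\mathbf w:=\rho(\hat{\mathbf w})\hat{\mathbf w}$ lies in $\mathcal N$; (ii) $\operatorname{dist}(\hat{\mathbf w},\mathcal N):=\inf_{\tilde{\mathbf w}\in\mathcal N}\|\hat{\mathbf w}-\tilde{\mathbf w}\|_H\le\|\mathbf w-\hat{\mathbf w}\|_H$, and $\|\mathbf w-\hat{\mathbf w}\|_H=o(\|\mathbf u-\bar{\mathbf u}\|_H)$ as $\|\mathbf u-\bar{\mathbf u}\|_H\to0$, uniformly on $\mathcal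 N$ and in $t$: for every $\eta>0$ there is $\delta>0$ such that for all $\mathbf u,\bar{\mathbf u}\in\mathcal N$ with $\|\mathbf u-\bar{\mathbf u}\|_H<\delta$ and all $t\in[0,1]$, $\|\mathbf w-\hat{\mathbf w}\|_H\le\eta\,\|\mathbf u-\bar{\mathbf u}\|_H$. -/

import Mathlib

open MeasureTheory Set Filter Topology
open scoped ContDiff ENNReal

noncomputable section

namespace Nehari

/-- The Euclidean space `ℝ^d`. -/
abbrev Rn (d : ℕ) : Type := EuclideanSpace ℝ (Fin d)

/-- The space `L²(Ω) × L²(Ω, ℝ^d)`, in which a Sobolev function `u` is represented by its graph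
`(u, ∇u)`; its norm induces the topology of the `H¹`-norm on such graphs. -/
abbrev GraphSpace {d : ℕ} (Ω : Set (Rn d)) : Type :=
  Lp ℝ 2 (volume.restrict Ω) × Lp (Rn d) 2 (volume.restrict Ω)

/-- `φ ∈ C_c^∞(Ω)`: smooth functions with compact support contained in `Ω`. -/
def IsTestFunction {d : ℕ} (Ω : Set (Rn d)) (φ : Rn d → ℝ) : Prop :=
  ContDiff ℝ ∞ φ ∧ HasCompactSupport φ ∧ tsupport φ ⊆ Ω

/-- The subspace `{(φ, ∇φ) : φ ∈ C_c^∞(Ω)}`. -/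
def testGraphs {d : ℕ} (Ω : Set (Rn d)) : Submodule ℝ (GraphSpace Ω) where
  carrier := {p | ∃ φ : Rn d → ℝ, IsTestFunction Ω φ ∧
    p.1 =ᵐ[volume.restrict Ω] φ ∧ p.2 =ᵐ[volume.restrict Ω] gradient φ}
  zero_mem' := by
    refine ⟨fun _ => 0, ⟨contDiff_const, HasCompactSupport.zero, ?_⟩, ?_, ?_⟩
    · simp [tsupport]
    · exact Lp.coeFn_zero _ _ _
    · have h : gradient (fun _ : Rn d => (0 : ℝ)) = 0 := by
        funext x; simp [gradient]
      rw [h]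
      exact Lp.coeFn_zero _ _ _
  add_mem' := by
    rintro p q ⟨φ, ⟨h1, h2, h3⟩, h4, h5⟩ ⟨ψ, ⟨k1, k2, k3⟩, k4, k5⟩
    refine ⟨φ + ψ, ⟨h1.add k1, h2.add k2, ?_⟩, ?_, ?_⟩
    · exact (tsupport_add φ ψ).trans (union_subset h3 k3)
    · exact (Lp.coeFn_add p.1 q.1).trans (h4.add k4)
    · have h : gradient (φ + ψ) = gradient φ + gradient ψ := by
        funext x
        simp only [gradient, Pi.add_apply]
        rw [fderiv_add (h1.differentiable (by simp) x) (k1.differentiable (by simp) x), map_add]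
      rw [h]
      exact (Lp.coeFn_add p.2 q.2).trans (h5.add k5)
  smul_mem' := by
    rintro c p ⟨φ, ⟨h1, h2, h3⟩, h4, h5⟩
    refine ⟨c • φ, ⟨contDiff_const.smul h1, h2.smul_left, ?_⟩, ?_, ?_⟩
    · exact (closure_mono (Function.support_const_smul_subset c φ)).trans h3
    · exact (Lp.coeFn_smul c p.1).trans (h4.const_smul c)
    · have h : gradient (c • φ) = c • gradient φ := by
        funext x
        simp only [gradient, Pi.smul_apply]
        rw [fderiv_const_smul (h1.differentiable (by simp) x), map_smulₛₗ]
        simp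
      rw [h]
      exact (Lp.coeFn_smul c p.2).trans (h5.const_smul c)

/-- The Sobolev space `H_0^1(Ω)`: the closure of `C_c^∞(Ω)` in the `H¹`-norm. An element is the
pair of a function `u` and its weak gradient `∇u` (the latter is determined by the former). -/
def H01 {d : ℕ} (Ω : Set (Rn d)) : Submodule ℝ (GraphSpace Ω) :=
  (testGraphs Ω).topologicalClosure

/-- The function `u` underlying an element of `H_0^1(Ω)`. -/
def val {d : ℕ} {Ω : Set (Rn d)} (u : H01 Ω) : Rn d → ℝ := u.1.1

/-- The weak gradient `∇u` of an element of `H_0^1(Ω)`. -/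
def grad {d : ℕ} {Ω : Set (Rn d)} (u : H01 Ω) : Rn d → Rn d := u.1.2

/-- `H = H_0^1(Ω, ℝ^m)`. As a normed space it carries the maximum of the `H¹`-norms of the
components, which is equivalent to the norm `hNorm` below; Fréchet derivatives are therefore
the same for both. -/
abbrev HSpace {d : ℕ} (Ω : Set (Rn d)) (m : ℕ) : Type := Fin m → H01 Ω

/-- `‖u‖_H = (∫_Ω ∑ᵢ εᵢ |∇uᵢ|²)^{1/2}`. -/
def hNorm {d m : ℕ} {Ω : Set (Rn d)} (ε : Fin m → ℝ) (u : HSpace Ω m) : ℝ :=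
  Real.sqrt (∫ x in Ω, ∑ i, ε i * ‖grad (u i) x‖ ^ 2)

/-- The first Dirichlet eigenvalue of `-Δ` in `Ω`,
`λ₁ = inf {∫_Ω |∇u|² : u ∈ H_0^1(Ω), ∫_Ω u² = 1}`. -/
def lambda1 {d : ℕ} (Ω : Set (Rn d)) : ℝ :=
  sInf {r | ∃ u : H01 Ω, ∫ x in Ω, val u x ^ 2 = 1 ∧ r = ∫ x in Ω, ‖grad u x‖ ^ 2}

/-- `K(u) = ∫_Ω ∑ᵢ (εᵢ |∇uᵢ|² + aᵢ uᵢ²)`. -/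
def K {d m : ℕ} {Ω : Set (Rn d)} (ε : Fin m → ℝ) (a : Fin m → Rn d → ℝ) (u : HSpace Ω m) : ℝ :=
  ∫ x in Ω, ∑ i, (ε i * ‖grad (u i) x‖ ^ 2 + a i x * val (u i) x ^ 2)

/-- `I(u) = ∫_Ω ∑ᵢⱼ gᵢⱼ uᵢ² uⱼ²`. -/
def I {d m : ℕ} {Ω : Set (Rn d)} (g : Matrix (Fin m) (Fin m) ℝ) (u : HSpace Ω m) : ℝ :=
  ∫ x in Ω, ∑ i, ∑ j, g i j * val (u i) x ^ 2 * val (u j) x ^ 2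

/-- The variational functional `E = K / 2 - I / 4`. -/
def E {d m : ℕ} {Ω : Set (Rn d)} (ε : Fin m → ℝ) (a : Fin m → Rn d → ℝ)
    (g : Matrix (Fin m) (Fin m) ℝ) (u : HSpace Ω m) : ℝ :=
  1 / 2 * K ε a u - 1 / 4 * I g u

/-- The Nehari manifold `{u ∈ H \ {0} : ⟨E'(u), u⟩ = 0}`, with `E'` the Fréchet derivative. -/
def nehari {d m : ℕ} (Ω : Set (Rn d)) (ε : Fin m → ℝ) (a : Fin m → Rn d → ℝ)
    (g : Matrix (Fin m) (Fin m) ℝ) : Set (HSpace Ω m) :=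
  {u | u ≠ 0 ∧ fderiv ℝ (E ε a g) u u = 0}

/-- `ρ(v) = (K(v) / I(v))^{1/2}`. -/
def rho {d m : ℕ} {Ω : Set (Rn d)} (ε : Fin m → ℝ) (a : Fin m → Rn d → ℝ)
    (g : Matrix (Fin m) (Fin m) ℝ) (v : HSpace Ω m) : ℝ :=
  Real.sqrt (K ε a v / I g v)

/-- `dist(v, S) = inf {‖v - s‖_H : s ∈ S}`. -/
def hDist {d m : ℕ} {Ω : Set (Rn d)} (ε : Fin m → ℝ) (v : HSpace Ω m)
    (S : Set (HSpace Ω m)) : ℝ :=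
  sInf ((fun s => hNorm ε (v - s)) '' S)

end Nehari

end

/-!
For `d ≤ 4` the space `H_0^1(Ω)` embeds into `L⁴(Ω)`, so `I` is a bounded quartic, comparable to
the fourth power of the `L⁴`-norm. The bilinear form of `K` is coercive: although `aᵢ + εᵢ λ₁ > 0`
is not uniform, the set where it is nearly violated has small measure, and there the `L⁴`-bound
controls `∫ uᵢ²`. By homogeneity the Nehari manifold is `{u ≠ 0 : K u = I u}`, which forces
`w ≠ 0` in (i) and bounds the `L⁴`-norm on it from below. For (ii), expand `K - I` at
`w = u + t (u - v)` as a polynomial in `t`: it vanishes at `t = 0` and at `t = -1`, where `w = v`,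
and this eliminates the linear term. Hence `K w - I w`, and with it `ρ(w) - 1`, is of second order
in `u - v`.
-/

noncomputable section

namespace Nehari

section Homogeneous

theorem fderiv_apply_self_of_homogeneous {V : Type*} [NormedAddCommGroup V] [NormedSpace ℝ V]
    {f : V → ℝ} {v : V} {n : ℕ} (hf : ∀ s : ℝ, f (s • v) = s ^ n * f v)
    (hd : DifferentiableAt ℝ f v) : fderiv ℝ f v v = n * f v := by
  have hray : HasDerivAt (fun s : ℝ => s • v) v 1 := by
    simpa using (hasDerivAt_id (1 : ℝ)).smul_const v
  have hchain : HasDerivAt (fun s : ℝ => f (s • v)) (fderiv ℝ f v v) 1 := by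
    have hd₁ : HasFDerivAt f (fderiv ℝ f v) ((1 : ℝ) • v) := by
      simpa only [one_smul] using hd.hasFDerivAt
    exact hd₁.comp_hasDerivAt 1 hray
  have hpow : HasDerivAt (fun s : ℝ => f (s • v)) (n * f v) 1 := by
    simpa [hf] using (hasDerivAt_pow n (1 : ℝ)).mul_const (f v)
  exact hchain.unique hpow

variable {V : Type*} [AddCommGroup V] [Module ℝ V] {k l : V → ℝ}

theorem add_smul_sub_ne_zero_of_homogeneous (hk : ∀ (s : ℝ) v, k (s • v) = s ^ 2 * k v)
    (hl : ∀ (s : ℝ) v, l (s • v) = s ^ 4 * l v) {u v : V} (hu : k u = l u) (hv : k v = l v)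
    (hpos : 0 < k u) {t : ℝ} (ht : 0 ≤ t) : u + t • (u - v) ≠ 0 := by
  intro h
  have hprop : t • v = (1 + t) • u := by
    rw [← sub_eq_zero, ← neg_eq_zero, ← h]; module
  have h2 : t ^ 2 * k v = (1 + t) ^ 2 * k u := by rw [← hk, ← hk, hprop]
  have h4 : t ^ 4 * k v = (1 + t) ^ 4 * k u := by rw [hv, hu, ← hl, ← hl, hprop]
  have h0 : (1 + t) ^ 2 * (1 + 2 * t) * k u = 0 := by linear_combination t ^ 2 * h2 - h4
  have : 0 < (1 + t) ^ 2 * (1 + 2 * t) * k u := by positivity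
  exact this.ne' h0

theorem balanced_sqrt_div_smul (hk : ∀ (s : ℝ) v, k (s • v) = s ^ 2 * k v)
    (hl : ∀ (s : ℝ) v, l (s • v) = s ^ 4 * l v) {w : V} (hkw : 0 ≤ k w) (hlw : 0 < l w) :
    k (√(k w / l w) • w) = l (√(k w / l w) • w) := by
  have hsq : √(k w / l w) ^ 2 = k w / l w := Real.sq_sqrt (div_nonneg hkw hlw.le)
  rw [hk, hl, show 4 = 2 * 2 from rfl, pow_mul, hsq]
  field_simp

end Homogeneous

theorem abs_sqrt_sub_one_le {x : ℝ} (hx : 0 ≤ x) : |√x - 1| ≤ |x - 1| := by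
  have h : x - 1 = (√x - 1) * (√x + 1) := by
    linear_combination -Real.sq_sqrt hx
  rw [h, abs_mul]
  exact le_mul_of_one_le_right (abs_nonneg _)
    ((le_add_of_nonneg_left (Real.sqrt_nonneg x)).trans (le_abs_self _))

theorem norm_sqrt_div_smul_sub_le {V : Type*} [NormedAddCommGroup V] [NormedSpace ℝ V]
    {b q : ℝ} (hb : 0 ≤ b) (hq : 0 < q) (w : V) :
    ‖√(b / q) • w - w‖ ≤ |b - q| / q * ‖w‖ := by
  have hsub : √(b / q) • w - w = (√(b / q) - 1) • w := by module
  have hquot : b / q - 1 = (b - q) / q := by field_simp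
  rw [hsub, norm_smul, Real.norm_eq_abs]
  gcongr
  calc |√(b / q) - 1| ≤ |b / q - 1| := abs_sqrt_sub_one_le (by positivity)
    _ = |b - q| / q := by rw [hquot, abs_div, abs_of_pos hq]

/-- Eliminating `f₁` leaves `f₂ (t + t²) + f₃ (t³ - t) + f₄ (t⁴ + t)`. -/
theorem abs_quartic_polynomial_le_of_root_neg_one {f₁ f₂ f₃ f₄ t : ℝ}
    (hroot : f₄ - f₃ + f₂ - f₁ = 0) (ht : t ∈ Icc (0 : ℝ) 1) :
    |f₁ * t + f₂ * t ^ 2 + f₃ * t ^ 3 + f₄ * t ^ 4| ≤ 2 * |f₂| + |f₃| + 2 * |f₄| := by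
  obtain ⟨ht0, ht1⟩ := ht
  have ht2 : t ^ 2 ≤ 1 := pow_le_one₀ ht0 ht1
  have ht3 : t ^ 3 ≤ 1 := pow_le_one₀ ht0 ht1
  have ht4 : t ^ 4 ≤ 1 := pow_le_one₀ ht0 ht1
  have h₂ : |t + t ^ 2| ≤ 2 := by rw [abs_of_nonneg (by positivity)]; linarith
  have h₃ : |t ^ 3 - t| ≤ 1 := by
    rw [abs_le]; constructor <;> linarith [pow_nonneg ht0 3]
  have h₄ : |t ^ 4 + t| ≤ 2 := by rw [abs_of_nonneg (by positivity)]; linarith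
  calc |f₁ * t + f₂ * t ^ 2 + f₃ * t ^ 3 + f₄ * t ^ 4|
      = |f₂ * (t + t ^ 2) + f₃ * (t ^ 3 - t) + f₄ * (t ^ 4 + t)| := by
        congr 1; linear_combination (-t) * hroot
    _ ≤ |f₂| * |t + t ^ 2| + |f₃| * |t ^ 3 - t| + |f₄| * |t ^ 4 + t| := by
        simp only [← abs_mul]; exact abs_add_three _ _ _
    _ ≤ |f₂| * 2 + |f₃| * 1 + |f₄| * 2 := by gcongr
    _ = 2 * |f₂| + |f₃| + 2 * |f₄| := by ring

section Quartic

variable {V Y W : Type*} [NormedAddCommGroup V] [NormedSpace ℝ V] [NormedAddCommGroup Y]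
  [NormedSpace ℝ Y] [NormedAddCommGroup W] [NormedSpace ℝ W]

/-- The quartic form `y ↦ G(P(y, y), P(y, y))` built from a bilinear map `P` and a bilinear
form `G`. -/
def quartic (P : Y →L[ℝ] Y →L[ℝ] W) (G : W →L[ℝ] W →L[ℝ] ℝ) (y : Y) : ℝ :=
  G (P y y) (P y y)

variable (P : Y →L[ℝ] Y →L[ℝ] W) (G : W →L[ℝ] W →L[ℝ] ℝ)

theorem quartic_smul (s : ℝ) (y : Y) : quartic P G (s • y) = s ^ 4 * quartic P G y := by
  simp only [quartic, map_smul, _root_.smul_apply, smul_eq_mul]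
  ring

theorem abs_quartic_le (y : Y) : |quartic P G y| ≤ ‖G‖ * ‖P‖ ^ 2 * ‖y‖ ^ 4 :=
  calc |quartic P G y| ≤ ‖G‖ * ‖P y y‖ * ‖P y y‖ := G.le_opNorm₂ _ _
    _ ≤ ‖G‖ * (‖P‖ * ‖y‖ * ‖y‖) * (‖P‖ * ‖y‖ * ‖y‖) := by gcongr <;> exact P.le_opNorm₂ _ _
    _ = ‖G‖ * ‖P‖ ^ 2 * ‖y‖ ^ 4 := by ring

theorem differentiable_quartic : Differentiable ℝ (quartic P G) := by
  unfold quartic; fun_prop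

/-- `P(x + sy, x + sy) = α + sβ + s²γ` with `β = P(x, y) + P(y, x)`. -/
theorem exists_quartic_add_smul_eq (x y : Y) : ∃ c₁ c₂ c₃ : ℝ,
    |c₂| ≤ 6 * (‖G‖ * ‖P‖ ^ 2) * ‖x‖ ^ 2 * ‖y‖ ^ 2 ∧
    |c₃| ≤ 4 * (‖G‖ * ‖P‖ ^ 2) * ‖x‖ * ‖y‖ ^ 3 ∧
    ∀ s : ℝ, quartic P G (x + s • y) =
      quartic P G x + c₁ * s + c₂ * s ^ 2 + c₃ * s ^ 3 + quartic P G y * s ^ 4 := by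
  set α := P x x with hα
  set β := P x y + P y x with hβ
  set γ := P y y with hγ
  have nα : ‖α‖ ≤ ‖P‖ * ‖x‖ ^ 2 := (P.le_opNorm₂ x x).trans_eq (by ring)
  have nβ : ‖β‖ ≤ 2 * ‖P‖ * ‖x‖ * ‖y‖ :=
    (norm_add_le_of_le (P.le_opNorm₂ x y) (P.le_opNorm₂ y x)).trans_eq (by ring)
  have nγ : ‖γ‖ ≤ ‖P‖ * ‖y‖ ^ 2 := (P.le_opNorm₂ y y).trans_eq (by ring)
  have bound {z z' : W} {r r' : ℝ} (hz : ‖z‖ ≤ r) (hz' : ‖z'‖ ≤ r') :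
      ‖G z z'‖ ≤ ‖G‖ * r * r' := G.le_of_opNorm₂_le_of_le le_rfl hz hz'
  refine ⟨G α β + G β α, G α γ + G β β + G γ α, G β γ + G γ β, ?_, ?_, fun s => ?_⟩
  · exact (norm_add_le_of_le (norm_add_le_of_le (bound nα nγ) (bound nβ nβ))
      (bound nγ nα)).trans_eq (by ring)
  · exact (norm_add_le_of_le (bound nβ nγ) (bound nγ nβ)).trans_eq (by ring)
  · have hP : P (x + s • y) (x + s • y) = α + s • β + s ^ 2 • γ := by
      simp only [hα, hβ, hγ, map_add, map_smul, _root_.add_apply, _root_.smul_apply]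
      module
    rw [quartic, hP, quartic, quartic, ← hα, ← hγ]
    simp only [map_add, map_smul, _root_.add_apply, _root_.smul_apply, smul_eq_mul]
    ring

variable {P G} {B : V →L[ℝ] V →L[ℝ] ℝ} {j : V →L[ℝ] Y}

theorem abs_sub_quartic_le {u v : V} (hu : B u u = quartic P G (j u))
    (huv : B (u - v) (u - v) = quartic P G (j (u - v))) {t : ℝ} (ht : t ∈ Icc (0 : ℝ) 1) :
    |B (u + t • v) (u + t • v) - quartic P G (j (u + t • v))| ≤
      2 * ‖B‖ * ‖v‖ ^ 2 + ‖G‖ * ‖P‖ ^ 2 *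
        (12 * ‖j u‖ ^ 2 * ‖j v‖ ^ 2 + 4 * ‖j u‖ * ‖j v‖ ^ 3 + 2 * ‖j v‖ ^ 4) := by
  obtain ⟨c₁, c₂, c₃, hc₂, hc₃, hQ⟩ := exists_quartic_add_smul_eq P G (j u) (j v)
  have hdefect (s : ℝ) : B (u + s • v) (u + s • v) - quartic P G (j (u + s • v)) =
      (B u v + B v u - c₁) * s + (B v v - c₂) * s ^ 2 + -c₃ * s ^ 3 +
        -quartic P G (j v) * s ^ 4 := by
    simp only [map_add, map_smul, hQ, hu, _root_.add_apply, _root_.smul_apply, smul_eq_mul]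
    ring
  have hroot := hdefect (-1)
  rw [neg_one_smul, ← sub_eq_add_neg, huv, sub_self] at hroot
  have hBvv : |B v v| ≤ ‖B‖ * ‖v‖ ^ 2 := (B.le_opNorm₂ v v).trans_eq (by ring)
  have h₂ : |B v v - c₂| ≤ |B v v| + |c₂| := abs_sub _ _
  have h₄ := abs_quartic_le P G (j v)
  have hpoly := abs_quartic_polynomial_le_of_root_neg_one (f₁ := B u v + B v u - c₁)
    (f₂ := B v v - c₂) (f₃ := -c₃) (f₄ := -quartic P G (j v)) (by linear_combination -hroot) ht
  rw [abs_neg, abs_neg] at hpoly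
  rw [hdefect]
  linarith

theorem exists_pos_forall_le_norm_of_balanced (hB : IsCoercive B) :
    ∃ r > 0, ∀ u ≠ 0, B u u = quartic P G (j u) → r ≤ ‖j u‖ := by
  obtain ⟨κ, hκ, hκB⟩ := hB
  have hD : 0 < ‖G‖ * ‖P‖ ^ 2 * ‖j‖ ^ 2 + 1 := by positivity
  refine ⟨√(κ / (‖G‖ * ‖P‖ ^ 2 * ‖j‖ ^ 2 + 1)), by positivity, fun u hu0 hu => ?_⟩
  rw [Real.sqrt_le_left (norm_nonneg _), div_le_iff₀ hD]
  have hu0' : 0 < ‖u‖ ^ 2 := by positivity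
  refine le_of_mul_le_mul_right ?_ hu0'
  calc κ * ‖u‖ ^ 2 = κ * ‖u‖ * ‖u‖ := by ring
    _ ≤ quartic P G (j u) := hu ▸ hκB u
    _ ≤ ‖G‖ * ‖P‖ ^ 2 * ‖j u‖ ^ 4 := (le_abs_self _).trans (abs_quartic_le P G _)
    _ = ‖G‖ * ‖P‖ ^ 2 * ‖j u‖ ^ 2 * ‖j u‖ ^ 2 := by ring
    _ ≤ ‖G‖ * ‖P‖ ^ 2 * ‖j u‖ ^ 2 * (‖j‖ * ‖u‖) ^ 2 := by gcongr; exact j.le_opNorm u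
    _ ≤ ‖j u‖ ^ 2 * (‖G‖ * ‖P‖ ^ 2 * ‖j‖ ^ 2 + 1) * ‖u‖ ^ 2 := by
      nlinarith [mul_nonneg (sq_nonneg ‖j u‖) hu0'.le]

theorem abs_sub_quartic_le_of_norm_map_le {r : ℝ} (hr : 0 < r) {u v : V}
    (hu : B u u = quartic P G (j u)) (huv : B (u - v) (u - v) = quartic P G (j (u - v)))
    (hru : r ≤ ‖j u‖) (hvu : ‖j v‖ ≤ ‖j u‖ / 2) {t : ℝ} (ht : t ∈ Icc (0 : ℝ) 1) :
    |B (u + t • v) (u + t • v) - quartic P G (j (u + t • v))| ≤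
      (2 * ‖B‖ / r ^ 2 + 15 * (‖G‖ * ‖P‖ ^ 2) * ‖j‖ ^ 2) * ‖j u‖ ^ 2 * ‖v‖ ^ 2 := by
  have hBv : ‖B‖ * ‖v‖ ^ 2 ≤ ‖B‖ / r ^ 2 * ‖j u‖ ^ 2 * ‖v‖ ^ 2 := by
    have : 1 ≤ ‖j u‖ ^ 2 / r ^ 2 := (one_le_div (by positivity)).2 (by gcongr)
    calc ‖B‖ * ‖v‖ ^ 2 ≤ ‖B‖ * ‖v‖ ^ 2 * (‖j u‖ ^ 2 / r ^ 2) :=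
          le_mul_of_one_le_right (by positivity) this
      _ = ‖B‖ / r ^ 2 * ‖j u‖ ^ 2 * ‖v‖ ^ 2 := by ring
  have hpoly : 12 * ‖j u‖ ^ 2 * ‖j v‖ ^ 2 + 4 * ‖j u‖ * ‖j v‖ ^ 3 + 2 * ‖j v‖ ^ 4 ≤
      15 * ‖j u‖ ^ 2 * ‖j v‖ ^ 2 := by
    have hfactor : 0 ≤ (‖j u‖ / 2 - ‖j v‖) * (6 * ‖j u‖ + 2 * ‖j v‖) * ‖j v‖ ^ 2 :=
      mul_nonneg (mul_nonneg (sub_nonneg.2 hvu) (by positivity)) (by positivity)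
    have hmixed : 0 ≤ ‖j u‖ * ‖j v‖ ^ 3 := by positivity
    linear_combination hfactor + hmixed
  calc _ ≤ 2 * ‖B‖ * ‖v‖ ^ 2 + ‖G‖ * ‖P‖ ^ 2 *
        (12 * ‖j u‖ ^ 2 * ‖j v‖ ^ 2 + 4 * ‖j u‖ * ‖j v‖ ^ 3 + 2 * ‖j v‖ ^ 4) :=
        abs_sub_quartic_le hu huv ht
    _ ≤ 2 * (‖B‖ / r ^ 2 * ‖j u‖ ^ 2 * ‖v‖ ^ 2) + ‖G‖ * ‖P‖ ^ 2 *
        (15 * ‖j u‖ ^ 2 * (‖j‖ * ‖v‖) ^ 2) := by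
        rw [mul_assoc 2 ‖B‖]
        gcongr
        refine hpoly.trans ?_
        gcongr
        exact j.le_opNorm v
    _ = _ := by ring

theorem norm_smul_le_of_mem_Icc {t : ℝ} (ht : t ∈ Icc (0 : ℝ) 1) (v : V) : ‖t • v‖ ≤ ‖v‖ := by
  rw [norm_smul, Real.norm_of_nonneg ht.1]
  exact mul_le_of_le_one_left (norm_nonneg v) ht.2

theorem half_norm_le_norm_add_smul {x y : V} (hyx : ‖y‖ ≤ ‖x‖ / 2) {t : ℝ}
    (ht : t ∈ Icc (0 : ℝ) 1) : ‖x‖ / 2 ≤ ‖x + t • y‖ := by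
  linarith [norm_sub_le_norm_add x (t • y), norm_smul_le_of_mem_Icc ht y]

theorem norm_add_smul_le_of_balanced {κ : ℝ} (hκ : 0 < κ)
    (hκB : ∀ u, κ * ‖u‖ * ‖u‖ ≤ B u u) {r : ℝ} (hr : 0 < r) {u v : V}
    (hu : B u u = quartic P G (j u)) (hru : r ≤ ‖j u‖) (hv : ‖v‖ ≤ r) {t : ℝ}
    (ht : t ∈ Icc (0 : ℝ) 1) :
    ‖u + t • v‖ ≤ (√(‖G‖ * ‖P‖ ^ 2 / κ) + r⁻¹) * ‖j u‖ ^ 2 := by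
  have hunorm : ‖u‖ ≤ √(‖G‖ * ‖P‖ ^ 2 / κ) * ‖j u‖ ^ 2 := by
    refine (sq_le_sq₀ (norm_nonneg u) (by positivity)).1 ?_
    rw [mul_pow, Real.sq_sqrt (by positivity), div_mul_eq_mul_div, le_div_iff₀ hκ]
    calc ‖u‖ ^ 2 * κ = κ * ‖u‖ * ‖u‖ := by ring
      _ ≤ quartic P G (j u) := hu ▸ hκB u
      _ ≤ ‖G‖ * ‖P‖ ^ 2 * ‖j u‖ ^ 4 := (le_abs_self _).trans (abs_quartic_le P G _)
      _ = ‖G‖ * ‖P‖ ^ 2 * (‖j u‖ ^ 2) ^ 2 := by ring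
  have htv : ‖t • v‖ ≤ r⁻¹ * ‖j u‖ ^ 2 :=
    calc ‖t • v‖ ≤ r := (norm_smul_le_of_mem_Icc ht v).trans hv
      _ = r⁻¹ * r ^ 2 := by field_simp
      _ ≤ r⁻¹ * ‖j u‖ ^ 2 := by gcongr
  exact (norm_add_le_of_le hunorm htv).trans_eq (by ring)

/-- Both the defect `B(w, w) - Q(jw)`, where `w = u + t(u - v)`, and `‖w‖` are `O(‖ju‖²)`, while
`Q(jw)` is at least of order `‖ju‖⁴`; so the bound is uniform although `u` is not confined to a
bounded set. -/
theorem exists_norm_sqrt_div_quartic_smul_sub_le (hB : IsCoercive B) {c : ℝ} (hc : 0 < c)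
    (hQ : ∀ v, c * ‖j v‖ ^ 4 ≤ quartic P G (j v)) :
    ∃ A > 0, ∃ δ > 0, ∀ u ≠ 0, ∀ v, B u u = quartic P G (j u) → B v v = quartic P G (j v) →
      ‖u - v‖ < δ → ∀ t ∈ Icc (0 : ℝ) 1, ∀ w, w = u + t • (u - v) →
        ‖√(B w w / quartic P G (j w)) • w - w‖ ≤ A * ‖u - v‖ ^ 2 := by
  obtain ⟨r, hr, hru⟩ := exists_pos_forall_le_norm_of_balanced (P := P) (G := G) (j := j) hB
  obtain ⟨κ, hκ, hκB⟩ := hB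
  set A₁ := 2 * ‖B‖ / r ^ 2 + 15 * (‖G‖ * ‖P‖ ^ 2) * ‖j‖ ^ 2
  set A₂ := √(‖G‖ * ‖P‖ ^ 2 / κ) + r⁻¹
  have hδ : 0 < min r (r / (2 * (‖j‖ + 1))) := by positivity
  refine ⟨16 * A₁ * A₂ / c + 1, by positivity, _, hδ, fun u hu0 v hu hv huv t ht w hw => ?_⟩
  obtain ⟨huvr, huvj⟩ := lt_min_iff.1 huv
  have hp := hru u hu0 hu
  have hp0 : 0 < ‖j u‖ := hr.trans_le hp
  have hjuv : ‖j (u - v)‖ ≤ ‖j u‖ / 2 := by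
    rw [lt_div_iff₀ (by positivity)] at huvj
    linarith [j.le_opNorm (u - v), norm_nonneg (u - v)]
  have hdefect : |B w w - quartic P G (j w)| ≤ A₁ * ‖j u‖ ^ 2 * ‖u - v‖ ^ 2 :=
    hw ▸ abs_sub_quartic_le_of_norm_map_le hr hu (by rwa [sub_sub_cancel]) hp hjuv ht
  have hwnorm : ‖w‖ ≤ A₂ * ‖j u‖ ^ 2 :=
    hw ▸ norm_add_smul_le_of_balanced hκ hκB hr hu hp huvr.le ht
  have hjw : ‖j u‖ / 2 ≤ ‖j w‖ := by
    simpa only [hw, map_add, map_smul] using half_norm_le_norm_add_smul hjuv ht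
  have hquartic : c * ‖j u‖ ^ 4 / 16 ≤ quartic P G (j w) :=
    calc c * ‖j u‖ ^ 4 / 16 = c * (‖j u‖ / 2) ^ 4 := by ring
      _ ≤ c * ‖j w‖ ^ 4 := by gcongr
      _ ≤ quartic P G (j w) := hQ w
  have hBw : 0 ≤ B w w := (by positivity : 0 ≤ κ * ‖w‖ * ‖w‖).trans (hκB w)
  calc ‖√(B w w / quartic P G (j w)) • w - w‖
      ≤ |B w w - quartic P G (j w)| / quartic P G (j w) * ‖w‖ :=
        norm_sqrt_div_smul_sub_le hBw (lt_of_lt_of_le (by positivity) hquartic) w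
    _ ≤ A₁ * ‖j u‖ ^ 2 * ‖u - v‖ ^ 2 / (c * ‖j u‖ ^ 4 / 16) * (A₂ * ‖j u‖ ^ 2) := by gcongr
    _ = 16 * A₁ * A₂ / c * ‖u - v‖ ^ 2 := by field_simp
    _ ≤ (16 * A₁ * A₂ / c + 1) * ‖u - v‖ ^ 2 := by gcongr; linarith

end Quartic

section Sobolev

open scoped NNReal

theorem enorm_le_lintegral_enorm_fderiv_of_finrank_eq_one {E F : Type*} [NormedAddCommGroup E]
    [InnerProductSpace ℝ E] [FiniteDimensional ℝ E] [MeasurableSpace E] [BorelSpace E]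
    [NormedAddCommGroup F] [NormedSpace ℝ F] (hE : Module.finrank ℝ E = 1) {f : E → F}
    (hf : ContDiff ℝ 1 f) (hfc : HasCompactSupport f) (x : E) :
    ‖f x‖ₑ ≤ ∫⁻ y, ‖fderiv ℝ f y‖ₑ := by
  let e : ℝ ≃ₗᵢ[ℝ] E :=
    (stdOrthonormalBasis ℝ ℝ).equiv (stdOrthonormalBasis ℝ E) (finCongr (by simp [hE]))
  have hderiv (s : ℝ) : ‖deriv (f ∘ e) s‖ₑ ≤ ‖fderiv ℝ f (e s)‖ₑ := by
    have he : HasDerivAt e (e 1) s := e.toContinuousLinearEquiv.hasFDerivAt.hasDerivAt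
    have h := (hf.differentiable one_ne_zero (e s)).hasFDerivAt.comp_hasDerivAt s he
    rw [h.deriv]
    refine (ContinuousLinearMap.le_opENorm _ _).trans_eq ?_
    rw [e.enorm_map, enorm_one, mul_one]
  calc ‖f x‖ₑ = ‖(f ∘ e) (e.symm x)‖ₑ := by simp
    _ ≤ ∫⁻ s in Iic (e.symm x), ‖deriv (f ∘ e) s‖ₑ :=
      (hfc.comp_homeomorph e.toHomeomorph).enorm_le_lintegral_Ici_deriv (hf.comp e.contDiff) _
    _ ≤ ∫⁻ s, ‖deriv (f ∘ e) s‖ₑ := setLIntegral_le_lintegral _ _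
    _ ≤ ∫⁻ s, ‖fderiv ℝ f (e s)‖ₑ := lintegral_mono hderiv
    _ = ∫⁻ y, ‖fderiv ℝ f y‖ₑ :=
      e.measurePreserving.lintegral_comp (f := fun y => ‖fderiv ℝ f y‖ₑ)
        (hf.continuous_fderiv one_ne_zero).enorm.measurable

theorem exists_eLpNorm_le_mul_eLpNorm {α F : Type*} [MeasurableSpace α] (μ : Measure α)
    [IsFiniteMeasure μ] [NormedAddCommGroup F] {p q : ℝ≥0∞} (hp : p ≠ 0) (hpq : p ≤ q) :
    ∃ C : ℝ≥0, ∀ f : α → F, AEStronglyMeasurable f μ → eLpNorm f p μ ≤ C * eLpNorm f q μ := by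
  have hexp : 0 ≤ 1 / p.toReal - 1 / q.toReal := by
    rcases eq_or_ne q ⊤ with rfl | hq
    · simp
    · exact sub_nonneg.2 (one_div_le_one_div_of_le
        (ENNReal.toReal_pos hp (ne_top_of_le_ne_top hq hpq)) (ENNReal.toReal_mono hq hpq))
  refine ⟨(μ univ ^ (1 / p.toReal - 1 / q.toReal)).toNNReal, fun f hf => ?_⟩
  rw [ENNReal.coe_toNNReal (ENNReal.rpow_ne_top_of_nonneg hexp (measure_ne_top μ univ)), mul_comm]
  exact eLpNorm_le_eLpNorm_mul_rpow_measure_univ hpq hf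

variable {d : ℕ} {Ω : Set (Rn d)} {φ : Rn d → ℝ}

theorem eLpNorm_gradient (φ : Rn d → ℝ) (p : ℝ≥0∞) (μ : Measure (Rn d)) :
    eLpNorm (gradient φ) p μ = eLpNorm (fderiv ℝ φ) p μ :=
  eLpNorm_congr_norm_ae (Eventually.of_forall fun _ => LinearIsometryEquiv.norm_map _ _)

namespace IsTestFunction

theorem contDiff_one (hφ : IsTestFunction Ω φ) : ContDiff ℝ 1 φ := hφ.1.of_le (by simp)

theorem differentiable (hφ : IsTestFunction Ω φ) : Differentiable ℝ φ :=
  hφ.contDiff_one.differentiable one_ne_zero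

theorem continuous_fderiv (hφ : IsTestFunction Ω φ) : Continuous (fderiv ℝ φ) :=
  hφ.contDiff_one.continuous_fderiv one_ne_zero

theorem support_subset (hφ : IsTestFunction Ω φ) : Function.support φ ⊆ Ω :=
  (subset_tsupport φ).trans hφ.2.2

theorem support_fderiv_subset (hφ : IsTestFunction Ω φ) : Function.support (fderiv ℝ φ) ⊆ Ω :=
  (_root_.support_fderiv_subset ℝ).trans hφ.2.2

theorem eLpNorm_restrict (hφ : IsTestFunction Ω φ) (p : ℝ≥0∞) :
    eLpNorm φ p (volume.restrict Ω) = eLpNorm φ p volume :=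
  eLpNorm_restrict_eq_of_support_subset hφ.support_subset

theorem eLpNorm_fderiv_restrict (hφ : IsTestFunction Ω φ) (p : ℝ≥0∞) :
    eLpNorm (fderiv ℝ φ) p (volume.restrict Ω) = eLpNorm (fderiv ℝ φ) p volume := by
  rw [← eLpNorm_norm, ← eLpNorm_norm (fderiv ℝ φ)]
  refine eLpNorm_restrict_eq_of_support_subset fun x hx => hφ.support_fderiv_subset ?_
  exact norm_ne_zero_iff.1 hx

theorem exists_eLpNorm_le_of_lt (hΩb : Bornology.IsBounded Ω) {p q : ℝ≥0} (hp1 : 1 ≤ p)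
    (hp2 : p ≤ 2) (hpd : p < d) (hpq : (p : ℝ)⁻¹ - (d : ℝ)⁻¹ ≤ (q : ℝ)⁻¹) :
    ∃ C : ℝ≥0, ∀ φ : Rn d → ℝ, IsTestFunction Ω φ →
      eLpNorm φ q (volume.restrict Ω) ≤ C * eLpNorm (gradient φ) 2 (volume.restrict Ω) := by
  have : IsFiniteMeasure (volume.restrict Ω) :=
    isFiniteMeasure_restrict.2 hΩb.measure_lt_top.ne
  obtain ⟨C, hC⟩ := exists_eLpNorm_le_mul_eLpNorm (F := Rn d →L[ℝ] ℝ) (volume.restrict Ω)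
    (p := p) (q := 2) (by exact_mod_cast (zero_lt_one.trans_le hp1).ne') (by exact_mod_cast hp2)
  refine ⟨eLpNormLESNormFDerivOfLeConst ℝ (volume : Measure (Rn d)) Ω p q * C, fun φ hφ => ?_⟩
  calc eLpNorm φ q (volume.restrict Ω)
      ≤ eLpNormLESNormFDerivOfLeConst ℝ (volume : Measure (Rn d)) Ω p q *
          eLpNorm (fderiv ℝ φ) p (volume.restrict Ω) := by
        rw [hφ.eLpNorm_restrict, hφ.eLpNorm_fderiv_restrict]
        exact eLpNorm_le_eLpNorm_fderiv_of_le volume hφ.contDiff_one hφ.support_subset hp1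
          (by simpa using hpd) (by simpa using hpq) hΩb
    _ ≤ _ * (C * eLpNorm (fderiv ℝ φ) 2 (volume.restrict Ω)) := by
        gcongr; exact hC _ hφ.continuous_fderiv.aestronglyMeasurable
    _ = _ := by rw [eLpNorm_gradient, ENNReal.coe_mul, mul_assoc]

theorem exists_eLpNorm_le_of_eq_one {Ω : Set (Rn 1)} (hΩb : Bornology.IsBounded Ω) (q : ℝ≥0∞) :
    ∃ C : ℝ≥0, ∀ φ : Rn 1 → ℝ, IsTestFunction Ω φ →
      eLpNorm φ q (volume.restrict Ω) ≤ C * eLpNorm (gradient φ) 2 (volume.restrict Ω) := by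
  have : IsFiniteMeasure (volume.restrict Ω) :=
    isFiniteMeasure_restrict.2 hΩb.measure_lt_top.ne
  obtain ⟨C, hC⟩ := exists_eLpNorm_le_mul_eLpNorm (F := Rn 1 →L[ℝ] ℝ) (volume.restrict Ω)
    one_ne_zero one_le_two
  have hvol : (volume.restrict Ω) univ ^ q.toReal⁻¹ ≠ ⊤ :=
    ENNReal.rpow_ne_top_of_nonneg (by positivity) (measure_ne_top _ _)
  refine ⟨((volume.restrict Ω) univ ^ q.toReal⁻¹).toNNReal * C, fun φ hφ => ?_⟩
  have hsup (x : Rn 1) : ‖φ x‖ₑ ≤ eLpNorm (fderiv ℝ φ) 1 (volume.restrict Ω) := by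
    rw [hφ.eLpNorm_fderiv_restrict, eLpNorm_one_eq_lintegral_enorm]
    exact enorm_le_lintegral_enorm_fderiv_of_finrank_eq_one (by simp) hφ.contDiff_one hφ.2.1 x
  rw [ENNReal.coe_mul, ENNReal.coe_toNNReal hvol, mul_assoc, eLpNorm_gradient]
  refine (eLpNorm_le_of_ae_enorm_bound (Eventually.of_forall hsup)).trans ?_
  rw [smul_eq_mul, mul_comm]
  gcongr
  exact hC _ hφ.continuous_fderiv.aestronglyMeasurable

theorem exists_eLpNorm_four_le (hd1 : 1 ≤ d) (hd4 : d ≤ 4) (hΩb : Bornology.IsBounded Ω) :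
    ∃ C : ℝ≥0, ∀ φ : Rn d → ℝ, IsTestFunction Ω φ →
      eLpNorm φ 4 (volume.restrict Ω) ≤ C * eLpNorm (gradient φ) 2 (volume.restrict Ω) := by
  interval_cases d
  · exact exists_eLpNorm_le_of_eq_one hΩb 4
  -- For `d = 2` the exponent `2` is critical; `W^{1,4/3}` already embeds into `L⁴`.
  · exact exists_eLpNorm_le_of_lt hΩb (p := 4 / 3) (q := 4) (by rw [← NNReal.coe_le_coe]; norm_num)
      (by rw [← NNReal.coe_le_coe]; norm_num) (by rw [← NNReal.coe_lt_coe]; norm_num) (by norm_num)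
  · exact exists_eLpNorm_le_of_lt hΩb (p := 2) (q := 4) (by norm_num) le_rfl (by norm_num)
      (by norm_num)
  · exact exists_eLpNorm_le_of_lt hΩb (p := 2) (q := 4) (by norm_num) le_rfl (by norm_num)
      (by norm_num)

theorem integral_fderiv_mul_add_integral_mul_inner_gradient (hφ : IsTestFunction Ω φ)
    {ψ : Rn d → ℝ} (hψ : ContDiff ℝ 1 ψ) (v : Rn d) :
    (∫ x in Ω, fderiv ℝ ψ x v * φ x) + ∫ x in Ω, ψ x * inner ℝ v (gradient φ x) = 0 := by
  have hgrad (x : Rn d) : inner ℝ v (gradient φ x) = fderiv ℝ φ x v := by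
    rw [real_inner_comm, gradient, InnerProductSpace.toDual_symm_apply]
  have hψ' : Continuous fun x => fderiv ℝ ψ x v :=
    (hψ.continuous_fderiv one_ne_zero).clm_apply continuous_const
  have hφ' : Continuous fun x => fderiv ℝ φ x v := hφ.continuous_fderiv.clm_apply continuous_const
  simp only [hgrad]
  rw [setIntegral_eq_integral_of_forall_compl_eq_zero,
    setIntegral_eq_integral_of_forall_compl_eq_zero,
    integral_mul_fderiv_eq_neg_fderiv_mul_of_integrable, add_neg_cancel]
  · exact (hψ'.mul hφ.1.continuous).integrable_of_hasCompactSupport hφ.2.1.mul_left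
  · exact (hψ.continuous.mul hφ').integrable_of_hasCompactSupport
      (hφ.2.1.fderiv_apply (𝕜 := ℝ) v).mul_left
  · exact (hψ.continuous.mul hφ.1.continuous).integrable_of_hasCompactSupport hφ.2.1.mul_left
  · exact fun x _ => hψ.differentiable one_ne_zero x
  · exact fun x _ => hφ.differentiable x
  · intro x hx
    rw [Function.notMem_support.1 fun h => hx (hφ.support_fderiv_subset h), zero_apply, mul_zero]
  · intro x hx
    rw [Function.notMem_support.1 fun h => hx (hφ.support_subset h), mul_zero]

end IsTestFunction

end Sobolev

section Embedding

open scoped NNReal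

variable {d : ℕ} {Ω : Set (Rn d)}

/-- The inclusion `H_0^1(Ω) → L²(Ω)`. -/
def valL : H01 Ω →L[ℝ] Lp ℝ 2 (volume.restrict Ω) :=
  (ContinuousLinearMap.fst ℝ _ _).comp (H01 Ω).subtypeL

/-- The weak gradient `H_0^1(Ω) → L²(Ω, ℝ^d)`. -/
def gradL : H01 Ω →L[ℝ] Lp (Rn d) 2 (volume.restrict Ω) :=
  (ContinuousLinearMap.snd ℝ _ _).comp (H01 Ω).subtypeL

theorem coeFn_valL (u : H01 Ω) : ⇑(valL u) = val u := rfl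

theorem norm_H01_def (u : H01 Ω) : ‖u‖ = max ‖valL u‖ ‖gradL u‖ := rfl

theorem memLp_val (u : H01 Ω) : MemLp (val u) 2 (volume.restrict Ω) := Lp.memLp _

theorem memLp_grad (u : H01 Ω) : MemLp (grad u) 2 (volume.restrict Ω) := Lp.memLp _

theorem integral_norm_sq_eq {α F : Type*} [MeasurableSpace α] {μ : Measure α}
    [NormedAddCommGroup F] [InnerProductSpace ℝ F] (f : Lp F 2 μ) :
    ∫ x, ‖f x‖ ^ 2 ∂μ = ‖f‖ ^ 2 := by
  rw [← real_inner_self_eq_norm_sq, L2.inner_def]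
  simp only [real_inner_self_eq_norm_sq]

theorem integral_grad_sq (u : H01 Ω) : ∫ x in Ω, ‖grad u x‖ ^ 2 = ‖gradL u‖ ^ 2 :=
  integral_norm_sq_eq (gradL u)

theorem integral_val_sq (u : H01 Ω) : ∫ x in Ω, val u x ^ 2 = ‖valL u‖ ^ 2 := by
  simpa only [Real.norm_eq_abs, sq_abs, coeFn_valL] using integral_norm_sq_eq (valL u)

theorem eLpNorm_val_le_of_forall_isTestFunction {C : ℝ≥0} {p : ℝ≥0∞}
    (hC : ∀ φ : Rn d → ℝ, IsTestFunction Ω φ →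
      eLpNorm φ p (volume.restrict Ω) ≤ C * eLpNorm (gradient φ) 2 (volume.restrict Ω))
    (u : H01 Ω) :
    eLpNorm (val u) p (volume.restrict Ω) ≤ C * eLpNorm (grad u) 2 (volume.restrict Ω) := by
  obtain ⟨w, hw, hlim⟩ := mem_closure_iff_seq_limit.1 u.2
  have hval : Tendsto (fun n => (w n).1) atTop (𝓝 u.1.1) := (continuous_fst.tendsto _).comp hlim
  have hgrad : Tendsto (fun n => (w n).2) atTop (𝓝 u.1.2) := (continuous_snd.tendsto _).comp hlim
  obtain ⟨ns, hns, hae⟩ := (tendstoInMeasure_of_tendsto_Lp hval).exists_seq_tendsto_ae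
  have hnorm : Tendsto (fun n => (C : ℝ≥0∞) * ‖(w (ns n)).2‖ₑ) atTop (𝓝 (C * ‖u.1.2‖ₑ)) :=
    ENNReal.Tendsto.const_mul ((continuous_enorm.tendsto _).comp (hgrad.comp hns.tendsto_atTop))
      (Or.inr ENNReal.coe_ne_top)
  calc eLpNorm (val u) p (volume.restrict Ω)
      ≤ liminf (fun n => eLpNorm (w (ns n)).1 p (volume.restrict Ω)) atTop :=
        Lp.eLpNorm_lim_le_liminf_eLpNorm (fun n => Lp.aestronglyMeasurable (w (ns n)).1) _ hae
    _ ≤ liminf (fun n => C * ‖(w (ns n)).2‖ₑ) atTop := by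
        refine liminf_le_liminf (Eventually.of_forall fun n => ?_)
        obtain ⟨φ, hφ, hφval, hφgrad⟩ := hw (ns n)
        rw [eLpNorm_congr_ae hφval, Lp.enorm_def, eLpNorm_congr_ae hφgrad]
        exact hC φ hφ
    _ = C * ‖u.1.2‖ₑ := hnorm.liminf_eq
    _ = C * eLpNorm (grad u) 2 (volume.restrict Ω) := by rw [Lp.enorm_def]; rfl

instance fact_one_le_four : Fact ((1 : ℝ≥0∞) ≤ 4) := ⟨by norm_num⟩

theorem exists_eLpNorm_four_val_le (hd1 : 1 ≤ d) (hd4 : d ≤ 4) (hΩb : Bornology.IsBounded Ω) :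
    ∃ C : ℝ≥0, ∀ u : H01 Ω,
      eLpNorm (val u) 4 (volume.restrict Ω) ≤ C * eLpNorm (grad u) 2 (volume.restrict Ω) := by
  obtain ⟨C, hC⟩ := IsTestFunction.exists_eLpNorm_four_le hd1 hd4 hΩb
  exact ⟨C, eLpNorm_val_le_of_forall_isTestFunction hC⟩

theorem exists_clm_ae_eq_val {p : ℝ≥0∞} [Fact (1 ≤ p)] {C : ℝ≥0}
    (hC : ∀ u : H01 Ω,
      eLpNorm (val u) p (volume.restrict Ω) ≤ C * eLpNorm (grad u) 2 (volume.restrict Ω)) :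
    ∃ J : H01 Ω →L[ℝ] Lp ℝ p (volume.restrict Ω), ∀ u, J u =ᵐ[volume.restrict Ω] val u := by
  have hmem (u : H01 Ω) : MemLp (val u) p (volume.restrict Ω) :=
    ⟨(memLp_val u).1, (hC u).trans_lt (ENNReal.mul_lt_top ENNReal.coe_lt_top (memLp_grad u).2)⟩
  let J : H01 Ω →ₗ[ℝ] Lp ℝ p (volume.restrict Ω) :=
    { toFun := fun u => (hmem u).toLp
      map_add' := fun u v => by
        rw [← MemLp.toLp_add]
        exact MemLp.toLp_congr _ _ (Lp.coeFn_add (valL u) (valL v))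
      map_smul' := fun c u => by
        rw [RingHom.id_apply, ← MemLp.toLp_const_smul]
        exact MemLp.toLp_congr _ _ (Lp.coeFn_smul c (valL u)) }
  have hbound (u : H01 Ω) : ‖J u‖ ≤ C * ‖u‖ :=
    calc ‖J u‖ = (eLpNorm (val u) p (volume.restrict Ω)).toReal := Lp.norm_toLp _ (hmem u)
      _ ≤ (C * eLpNorm (grad u) 2 (volume.restrict Ω)).toReal :=
        ENNReal.toReal_mono (ENNReal.mul_ne_top ENNReal.coe_ne_top (memLp_grad u).2.ne) (hC u)
      _ = C * ‖gradL u‖ := by rw [ENNReal.toReal_mul, ENNReal.coe_toReal, Lp.norm_def]; rfl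
      _ ≤ C * ‖u‖ := by gcongr; exact le_max_right _ _
  exact ⟨J.mkContinuous C hbound, fun u => (hmem u).coeFn_toLp⟩

theorem exists_clm_four_ae_eq_val (hd1 : 1 ≤ d) (hd4 : d ≤ 4) (hΩb : Bornology.IsBounded Ω) :
    ∃ J : H01 Ω →L[ℝ] Lp ℝ 4 (volume.restrict Ω), ∀ u, J u =ᵐ[volume.restrict Ω] val u := by
  obtain ⟨C, hC⟩ := exists_eLpNorm_four_val_le hd1 hd4 hΩb
  exact exists_clm_ae_eq_val hC

theorem exists_norm_le_mul_norm_gradL (hd1 : 1 ≤ d) (hd4 : d ≤ 4)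
    (hΩb : Bornology.IsBounded Ω) : ∃ C > 0, ∀ u : H01 Ω, ‖u‖ ≤ C * ‖gradL u‖ := by
  have : IsFiniteMeasure (volume.restrict Ω) :=
    isFiniteMeasure_restrict.2 hΩb.measure_lt_top.ne
  obtain ⟨C₄, hC₄⟩ := exists_eLpNorm_four_val_le hd1 hd4 hΩb
  obtain ⟨C₂, hC₂⟩ := exists_eLpNorm_le_mul_eLpNorm (F := ℝ) (volume.restrict Ω)
    two_ne_zero (show (2 : ℝ≥0∞) ≤ 4 by norm_num)
  have hval (u : H01 Ω) : ‖valL u‖ ≤ C₂ * C₄ * ‖gradL u‖ := by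
    have h : ‖valL u‖ₑ ≤ C₂ * C₄ * ‖gradL u‖ₑ :=
      calc ‖valL u‖ₑ = eLpNorm (val u) 2 (volume.restrict Ω) := Lp.enorm_def _
        _ ≤ C₂ * eLpNorm (val u) 4 (volume.restrict Ω) := hC₂ _ (memLp_val u).1
        _ ≤ C₂ * (C₄ * eLpNorm (grad u) 2 (volume.restrict Ω)) := by gcongr; exact hC₄ u
        _ = C₂ * C₄ * ‖gradL u‖ₑ := by rw [Lp.enorm_def, mul_assoc]; rfl
    rw [enorm_eq_nnnorm, enorm_eq_nnnorm] at h
    exact_mod_cast h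
  refine ⟨C₂ * C₄ + 1, by positivity, fun u => ?_⟩
  have hC : 0 ≤ C₂ * C₄ * ‖gradL u‖ := by positivity
  rw [norm_H01_def, add_one_mul]
  exact max_le ((hval u).trans (le_add_of_nonneg_right (norm_nonneg _))) (le_add_of_nonneg_left hC)

theorem integral_fderiv_mul_val_add_integral_mul_inner_grad (u : H01 Ω) {ψ : Rn d → ℝ}
    (hψ : ContDiff ℝ 1 ψ) (hψc : HasCompactSupport ψ) (v : Rn d) :
    (∫ x in Ω, fderiv ℝ ψ x v * val u x) + ∫ x in Ω, ψ x * inner ℝ v (grad u x) = 0 := by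
  have hψ' : MemLp (fun x => fderiv ℝ ψ x v) 2 (volume.restrict Ω) :=
    ((hψ.continuous_fderiv one_ne_zero).clm_apply continuous_const).memLp_of_hasCompactSupport
      (hψc.fderiv_apply (𝕜 := ℝ) v)
  have hψv : MemLp (fun x => ψ x • v) 2 (volume.restrict Ω) :=
    (hψ.continuous.smul continuous_const).memLp_of_hasCompactSupport hψc.smul_right
  have hinner (p : GraphSpace Ω) : inner ℝ hψ'.toLp p.1 + inner ℝ hψv.toLp p.2 =
      (∫ x in Ω, fderiv ℝ ψ x v * p.1 x) + ∫ x in Ω, ψ x * inner ℝ v (p.2 x) := by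
    rw [L2.inner_def, L2.inner_def]
    congr 1 <;> refine integral_congr_ae ?_
    · filter_upwards [hψ'.coeFn_toLp] with x hx
      rw [hx, real_inner_comm, RCLike.inner_apply, conj_trivial, mul_comm]
    · filter_upwards [hψv.coeFn_toLp] with x hx
      rw [hx, real_inner_smul_left]
  have hclosed : IsClosed {p : GraphSpace Ω | inner ℝ hψ'.toLp p.1 + inner ℝ hψv.toLp p.2 = 0} :=
    isClosed_eq (by fun_prop) continuous_const
  have htest : (testGraphs Ω : Set (GraphSpace Ω)) ⊆
      {p | inner ℝ hψ'.toLp p.1 + inner ℝ hψv.toLp p.2 = 0} := by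
    rintro p ⟨φ, hφ, hp₁, hp₂⟩
    rw [mem_ofPred_eq, hinner, ← hφ.integral_fderiv_mul_add_integral_mul_inner_gradient hψ v]
    congr 1 <;> refine integral_congr_ae ?_
    · filter_upwards [hp₁] with x hx
      rw [hx]
    · filter_upwards [hp₂] with x hx
      rw [hx]
  exact (hinner u.1).symm.trans (closure_minimal htest hclosed u.2)

theorem eq_zero_of_val_ae_eq_zero {u : H01 Ω} (hu : val u =ᵐ[volume.restrict Ω] 0) : u = 0 := by
  have hlocal : LocallyIntegrable (grad u) (volume.restrict Ω) :=
    (memLp_grad u).locallyIntegrable one_le_two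
  have hgrad : grad u =ᵐ[volume.restrict Ω] 0 := by
    refine ae_eq_zero_of_integral_contDiff_smul_eq_zero hlocal fun ψ hψ hψc => ?_
    have hint : Integrable (fun x => ψ x • grad u x) (volume.restrict Ω) :=
      hlocal.integrable_smul_left_of_hasCompactSupport hψ.continuous hψc
    refine ext_inner_left ℝ fun v => ?_
    have hweak := integral_fderiv_mul_val_add_integral_mul_inner_grad u
      (hψ.of_le (by simp)) hψc v
    have hval : ∫ x in Ω, fderiv ℝ ψ x v * val u x = 0 :=
      integral_eq_zero_of_ae (hu.mono fun x hx => by simp [hx])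
    rw [hval, zero_add] at hweak
    rw [← integral_inner hint, inner_zero_right, ← hweak]
    simp only [real_inner_smul_right]
  exact Subtype.ext (Prod.ext (Lp.eq_zero_iff_ae_eq_zero.2 hu) (Lp.eq_zero_iff_ae_eq_zero.2 hgrad))

end Embedding

section Weight

variable {α : Type*} [MeasurableSpace α] {μ : Measure α}

instance holderTriple_four_four_two : ENNReal.HolderTriple 4 4 2 := ⟨by
  rw [← two_mul, show (4 : ℝ≥0∞) = 2 * 2 by norm_num,
    ENNReal.mul_inv (by simp) (by simp), ← mul_assoc,
    ENNReal.mul_inv_cancel (by simp) (by simp), one_mul]⟩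

variable (μ) in
/-- Multiplication of functions as a bounded bilinear map `L⁴ × L⁴ → L²`. -/
def mulL4 : Lp ℝ 4 μ →L[ℝ] Lp ℝ 4 μ →L[ℝ] Lp ℝ 2 μ :=
  (ContinuousLinearMap.mul ℝ ℝ).holderL μ 4 4 2

theorem coeFn_mulL4 (f g : Lp ℝ 4 μ) : mulL4 μ f g =ᵐ[μ] fun x => f x * g x :=
  ContinuousLinearMap.coeFn_holder _ f g

theorem norm_mulL4_le (f g : Lp ℝ 4 μ) : ‖mulL4 μ f g‖ ≤ ‖f‖ * ‖g‖ :=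
  (ContinuousLinearMap.norm_holder_apply_apply_le _ f g).trans_eq
    (by rw [ContinuousLinearMap.opNorm_mul, one_mul])

theorem norm_mulL4_self (f : Lp ℝ 4 μ) : ‖mulL4 μ f f‖ = ‖f‖ ^ 2 := by
  rw [Lp.norm_def, eLpNorm_congr_ae (coeFn_mulL4 f f), Lp.norm_def, ← ENNReal.toReal_pow]
  congr 1
  have hpow := eLpNorm_norm_rpow (p := 2) (μ := μ) (f : α → ℝ) (q := 2) two_pos
  rw [ENNReal.ofReal_ofNat, show (2 : ℝ≥0∞) * 2 = 4 by norm_num, ENNReal.rpow_ofNat] at hpow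
  rw [← hpow]
  refine eLpNorm_congr_ae (Eventually.of_forall fun x => ?_)
  simp only [Real.rpow_ofNat, Real.norm_eq_abs, sq_abs, ← sq]

theorem integrable_mul_sq {b f : α → ℝ} (hb : MemLp b ∞ μ) (hf : MemLp f 2 μ) :
    Integrable (fun x => b x * f x ^ 2) μ :=
  hf.integrable_sq.essSup_smul hb.1 hb.2.ne

variable [IsFiniteMeasure μ]

theorem exists_measurableSet_measure_lt_of_ae_pos {f : α → ℝ} (hf : AEMeasurable f μ)
    (hpos : ∀ᵐ x ∂μ, 0 < f x) {δ : ℝ≥0∞} (hδ : 0 < δ) :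
    ∃ A, MeasurableSet A ∧ μ A < δ ∧ ∃ n > 0, ∀ x ∉ A, 1 ≤ n * f x := by
  have hanti : Antitone fun n : ℕ => {x | f x ≤ (n + 1 : ℝ)⁻¹} :=
    fun k n hkn x (hx : f x ≤ _) => hx.trans (by gcongr)
  have hnull : μ (⋂ n : ℕ, {x | f x ≤ (n + 1 : ℝ)⁻¹}) = 0 := by
    refine measure_mono_null (fun x hx => ?_) (ae_iff.1 hpos)
    exact not_lt.2 (ge_of_tendsto' (tendsto_inv_atTop_zero.comp
      (tendsto_atTop_add_const_right _ 1 tendsto_natCast_atTop_atTop)) (mem_iInter.1 hx))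
  have hlim := tendsto_measure_iInter_atTop (μ := μ)
    (fun n : ℕ => nullMeasurableSet_le hf (aemeasurable_const (b := (n + 1 : ℝ)⁻¹))) hanti
    ⟨0, measure_ne_top _ _⟩
  rw [hnull] at hlim
  obtain ⟨n, hn⟩ := (hlim.eventually_lt_const hδ).exists
  refine ⟨toMeasurable μ _, measurableSet_toMeasurable _ _, (measure_toMeasurable _).trans_lt hn,
    n + 1, by positivity, fun x hx => ?_⟩
  have hlt : (n + 1 : ℝ)⁻¹ < f x := not_le.1 fun h => hx (subset_toMeasurable μ _ h)
  calc (1 : ℝ) = (n + 1) * (n + 1 : ℝ)⁻¹ := (mul_inv_cancel₀ (by positivity)).symm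
    _ ≤ (n + 1) * f x := by gcongr

theorem setIntegral_sq_le {A : Set α} (hA : MeasurableSet A) (f : Lp ℝ 4 μ) :
    ∫ x in A, f x ^ 2 ∂μ ≤ √(μ.real A) * ‖f‖ ^ 2 := by
  have hsq : mulL4 μ f f =ᵐ[μ] fun x => f x ^ 2 :=
    (coeFn_mulL4 f f).trans (Eventually.of_forall fun x => (sq (f x)).symm)
  calc ∫ x in A, f x ^ 2 ∂μ = ∫ x in A, mulL4 μ f f x ∂μ :=
        (integral_congr_ae (ae_restrict_of_ae hsq)).symm
    _ = inner ℝ (indicatorConstLp 2 hA (measure_ne_top μ A) (1 : ℝ)) (mulL4 μ f f) :=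
        (L2.inner_indicatorConstLp_one hA _ _).symm
    _ ≤ ‖indicatorConstLp 2 hA (measure_ne_top μ A) (1 : ℝ)‖ * ‖mulL4 μ f f‖ :=
        real_inner_le_norm _ _
    _ ≤ √(μ.real A) * ‖f‖ ^ 2 := by
        rw [norm_indicatorConstLp two_ne_zero ENNReal.ofNat_ne_top, norm_one, one_mul,
          ENNReal.toReal_ofNat, ← Real.sqrt_eq_rpow, norm_mulL4_self]

theorem exists_integral_sq_le_of_ae_pos {b : α → ℝ} (hb : MemLp b ∞ μ) (hpos : ∀ᵐ x ∂μ, 0 < b x)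
    {δ : ℝ} (hδ : 0 < δ) :
    ∃ n > 0, ∀ f : Lp ℝ 4 μ, ∫ x, f x ^ 2 ∂μ ≤ n * ∫ x, b x * f x ^ 2 ∂μ + δ * ‖f‖ ^ 2 := by
  obtain ⟨A, hA, hμA, n, hn, hnb⟩ := exists_measurableSet_measure_lt_of_ae_pos
    hb.1.aemeasurable hpos (ENNReal.ofReal_pos.2 (pow_pos hδ 2))
  refine ⟨n, hn, fun f => ?_⟩
  have hf : MemLp f 2 μ := (Lp.memLp f).mono_exponent (by norm_num)
  have hbf := (integrable_mul_sq hb hf).const_mul n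
  have hsmall : √(μ.real A) ≤ δ :=
    Real.sqrt_le_iff.2 ⟨hδ.le, ENNReal.toReal_le_of_le_ofReal (by positivity) hμA.le⟩
  calc ∫ x, f x ^ 2 ∂μ ≤ ∫ x, (n * (b x * f x ^ 2) + A.indicator (fun x => f x ^ 2) x) ∂μ := by
        refine integral_mono_ae hf.integrable_sq (hbf.add (hf.integrable_sq.indicator hA)) ?_
        filter_upwards [hpos] with x hx
        by_cases hxA : x ∈ A
        · rw [indicator_of_mem hxA]
          exact le_add_of_nonneg_left (by positivity)
        · rw [indicator_of_notMem hxA, add_zero, ← mul_assoc]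
          exact le_mul_of_one_le_left (sq_nonneg _) (hnb x hxA)
    _ = n * ∫ x, b x * f x ^ 2 ∂μ + ∫ x in A, f x ^ 2 ∂μ := by
        rw [integral_add hbf (hf.integrable_sq.indicator hA), integral_const_mul,
          integral_indicator hA]
    _ ≤ n * ∫ x, b x * f x ^ 2 ∂μ + δ * ‖f‖ ^ 2 := by
        gcongr
        exact (setIntegral_sq_le hA f).trans (by gcongr)

end Weight

section Coercive

theorem half_mul_le_of_le_add {l s D T n τ ε : ℝ} (hl : 0 ≤ l) (hs : 0 ≤ s) (hsD : l * s ≤ D)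
    (hT : 0 ≤ T) (hτ : 0 ≤ τ) (hτε : τ ≤ ε) (hτn : τ * n * (l + 1) ≤ 1)
    (hsT : s ≤ n * T + D / (2 * (l + 1))) : τ / 2 * D ≤ ε * (D - l * s) + T := by
  calc τ / 2 * D = τ * (D - (l + 1) * (n * T + D / (2 * (l + 1)))) + τ * n * (l + 1) * T := by
        field_simp; ring
    _ ≤ τ * (D - (l + 1) * s) + 1 * T := by gcongr
    _ ≤ τ * (D - l * s) + T := by
        have : 0 ≤ τ * s := by positivity
        linear_combination this
    _ ≤ ε * (D - l * s) + T := by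
        have : 0 ≤ D - l * s := sub_nonneg.2 hsD
        gcongr

theorem pi_norm_sq_le {ι : Type*} [Fintype ι] {V : ι → Type*} [∀ i, SeminormedAddCommGroup (V i)]
    {v : ∀ i, V i} {r : ℝ} (hr : 0 ≤ r) (hv : ∀ i, ‖v i‖ ^ 2 ≤ r) : ‖v‖ ^ 2 ≤ r :=
  (Real.le_sqrt (norm_nonneg v) hr).1 <|
    (pi_norm_le_iff_of_nonneg (Real.sqrt_nonneg r)).2 fun i => Real.le_sqrt_of_sq_le (hv i)

variable {V : Type*} [NormedAddCommGroup V] [NormedSpace ℝ V]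

theorem isCoercive_of_mul_le {B B' : V →L[ℝ] V →L[ℝ] ℝ} (hB : IsCoercive B) {c : ℝ} (hc : 0 < c)
    (h : ∀ v, c * B v v ≤ B' v v) : IsCoercive B' := by
  obtain ⟨κ, hκ, hκB⟩ := hB
  refine ⟨c * κ, by positivity, fun v => ?_⟩
  calc c * κ * ‖v‖ * ‖v‖ = c * (κ * ‖v‖ * ‖v‖) := by ring
    _ ≤ c * B v v := by gcongr; exact hκB v
    _ ≤ B' v v := h v

theorem apply_self_pos_of_isCoercive {B : V →L[ℝ] V →L[ℝ] ℝ} (hB : IsCoercive B) {v : V}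
    (hv : v ≠ 0) : 0 < B v v := by
  obtain ⟨κ, hκ, hκB⟩ := hB
  have : 0 < ‖v‖ := norm_pos_iff.2 hv
  exact (by positivity : 0 < κ * ‖v‖ * ‖v‖).trans_le (hκB v)

theorem apply_smul_self (B : V →L[ℝ] V →L[ℝ] ℝ) (s : ℝ) (v : V) :
    B (s • v) (s • v) = s ^ 2 * B v v := by
  simp only [map_smul, _root_.smul_apply, smul_eq_mul]
  ring

theorem apply_sub_self_comm (B : V →L[ℝ] V →L[ℝ] ℝ) (u v : V) :
    B (u - v) (u - v) = B (v - u) (v - u) := by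
  rw [← neg_sub v u, map_neg, map_neg, _root_.neg_apply, neg_neg]

theorem differentiable_apply_self (B : V →L[ℝ] V →L[ℝ] ℝ) : Differentiable ℝ fun v => B v v := by
  fun_prop

theorem sqrt_apply_self_le (B : V →L[ℝ] V →L[ℝ] ℝ) (v : V) : √(B v v) ≤ √‖B‖ * ‖v‖ := by
  refine Real.sqrt_le_iff.2 ⟨by positivity, ?_⟩
  calc B v v ≤ ‖B‖ * ‖v‖ * ‖v‖ := (le_abs_self _).trans (B.le_opNorm₂ v v)
    _ = (√‖B‖ * ‖v‖) ^ 2 := by rw [mul_pow, Real.sq_sqrt (norm_nonneg B)]; ring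

theorem exists_mul_norm_le_sqrt_apply_self {B : V →L[ℝ] V →L[ℝ] ℝ} (hB : IsCoercive B) :
    ∃ c > 0, ∀ v, c * ‖v‖ ≤ √(B v v) := by
  obtain ⟨κ, hκ, hκB⟩ := hB
  refine ⟨√κ, Real.sqrt_pos.2 hκ, fun v => Real.le_sqrt_of_sq_le ?_⟩
  calc (√κ * ‖v‖) ^ 2 = κ * ‖v‖ * ‖v‖ := by rw [mul_pow, Real.sq_sqrt hκ.le]; ring
    _ ≤ B v v := hκB v

variable {ι : Type*} [Fintype ι]

/-- The form `(u, v) ↦ ∑ᵢ Bᵢ(uᵢ, vᵢ)` on a finite power of `V`. -/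
def diagForm (B : ι → V →L[ℝ] V →L[ℝ] ℝ) : (ι → V) →L[ℝ] (ι → V) →L[ℝ] ℝ :=
  ∑ i, (B i).bilinearComp (ContinuousLinearMap.proj i) (ContinuousLinearMap.proj i)

theorem diagForm_apply (B : ι → V →L[ℝ] V →L[ℝ] ℝ) (u v : ι → V) :
    diagForm B u v = ∑ i, B i (u i) (v i) := by
  simp only [diagForm, _root_.sum_apply, ContinuousLinearMap.bilinearComp_apply,
    ContinuousLinearMap.proj_apply]

theorem isCoercive_diagForm {B : ι → V →L[ℝ] V →L[ℝ] ℝ} (hB : ∀ i, IsCoercive (B i)) :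
    IsCoercive (diagForm B) := by
  choose κ hκ hκB using hB
  obtain ⟨k, hkκ, hk⟩ : ∃ k : ℝ, (∀ i, k ≤ κ i) ∧ 0 < k :=
    ((eventually_all.2 fun i => Ioc_mem_nhdsGT (hκ i)).mono (fun k hk i => (hk i).2)
      |>.and self_mem_nhdsWithin).exists
  have hpos (v : V) (i : ι) : k * ‖v‖ ^ 2 ≤ B i v v :=
    calc k * ‖v‖ ^ 2 ≤ κ i * ‖v‖ ^ 2 := by gcongr; exact hkκ i
      _ = κ i * ‖v‖ * ‖v‖ := by ring
      _ ≤ B i v v := hκB i v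
  refine ⟨k, hk, fun u => ?_⟩
  have hnonneg (i : ι) : 0 ≤ B i (u i) (u i) := (by positivity : 0 ≤ k * _).trans (hpos (u i) i)
  rw [mul_assoc, ← sq, ← le_div_iff₀' hk, diagForm_apply]
  refine pi_norm_sq_le (div_nonneg (Finset.sum_nonneg fun i _ => hnonneg i) hk.le) fun i => ?_
  rw [le_div_iff₀' hk]
  exact (hpos (u i) i).trans (Finset.single_le_sum (fun i _ => hnonneg i) (Finset.mem_univ i))

end Coercive

section Dirichlet

variable {d : ℕ} {Ω : Set (Rn d)}

-- Without these two shortcuts, the instance search for sums of bilinear forms on `H01 Ω` times out.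
instance : NormedAddCommGroup (H01 Ω) := Submodule.normedAddCommGroup _

instance : NormedSpace ℝ (H01 Ω) := Submodule.normedSpace _

theorem lambda1_nonneg : 0 ≤ lambda1 Ω := by
  refine Real.sInf_nonneg ?_
  rintro r ⟨u, -, rfl⟩
  positivity

theorem lambda1_mul_norm_valL_sq_le (u : H01 Ω) : lambda1 Ω * ‖valL u‖ ^ 2 ≤ ‖gradL u‖ ^ 2 := by
  rcases eq_or_ne ‖valL u‖ 0 with hu | hu
  · rw [hu, zero_pow two_ne_zero, mul_zero]
    positivity
  have hbdd : BddBelow {r | ∃ u : H01 Ω, ∫ x in Ω, val u x ^ 2 = 1 ∧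
      r = ∫ x in Ω, ‖grad u x‖ ^ 2} := by
    refine ⟨0, ?_⟩
    rintro r ⟨v, -, rfl⟩
    positivity
  have hnormalized : ∫ x in Ω, val (‖valL u‖⁻¹ • u) x ^ 2 = 1 := by
    rw [integral_val_sq, map_smul, norm_smul, norm_inv, norm_norm, inv_mul_cancel₀ hu, one_pow]
  have hle : lambda1 Ω ≤ ‖gradL (‖valL u‖⁻¹ • u)‖ ^ 2 :=
    csInf_le hbdd ⟨_, hnormalized, (integral_grad_sq _).symm⟩
  rwa [map_smul, norm_smul, norm_inv, norm_norm, mul_pow, inv_pow, ← div_eq_inv_mul,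
    le_div_iff₀ (by positivity)] at hle

variable (Ω) in
/-- The Dirichlet form `(u, v) ↦ ∫_Ω ∇u · ∇v`. -/
def gradForm : H01 Ω →L[ℝ] H01 Ω →L[ℝ] ℝ :=
  (innerSL ℝ).bilinearComp gradL gradL

theorem gradForm_self (u : H01 Ω) : gradForm Ω u u = ‖gradL u‖ ^ 2 :=
  real_inner_self_eq_norm_sq (gradL u)

theorem isCoercive_gradForm (hd1 : 1 ≤ d) (hd4 : d ≤ 4) (hΩb : Bornology.IsBounded Ω) :
    IsCoercive (gradForm Ω) := by
  obtain ⟨C, hC, hCu⟩ := exists_norm_le_mul_norm_gradL hd1 hd4 hΩb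
  refine ⟨(C ^ 2)⁻¹, by positivity, fun u => ?_⟩
  rw [gradForm_self, mul_assoc, ← sq, inv_mul_le_iff₀ (by positivity), ← mul_pow]
  gcongr
  exact hCu u

/-- The form `(u, v) ↦ ∫_Ω b u v` of a bounded potential `b`. -/
def potentialForm {b : Rn d → ℝ} (hb : MemLp b ∞ (volume.restrict Ω)) :
    H01 Ω →L[ℝ] H01 Ω →L[ℝ] ℝ :=
  (innerSL ℝ).bilinearComp
    (((ContinuousLinearMap.mul ℝ ℝ).holderL (volume.restrict Ω) ∞ 2 2 hb.toLp).comp valL) valL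

theorem potentialForm_self {b : Rn d → ℝ} (hb : MemLp b ∞ (volume.restrict Ω)) (u : H01 Ω) :
    potentialForm hb u u = ∫ x in Ω, b x * val u x ^ 2 := by
  have hmul := ContinuousLinearMap.coeFn_holder (r := 2) (ContinuousLinearMap.mul ℝ ℝ) hb.toLp
    (valL u)
  refine (L2.inner_def _ _).trans (integral_congr_ae ?_)
  filter_upwards [hmul, hb.coeFn_toLp] with x hx hbx
  change val u x * (ContinuousLinearMap.mul ℝ ℝ).holder 2 hb.toLp (valL u) x = _
  rw [hx, hbx, ContinuousLinearMap.mul_apply', coeFn_valL]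
  ring

theorem integral_add_const_mul_val_sq {b : Rn d → ℝ} (hb : MemLp b ∞ (volume.restrict Ω)) (c : ℝ)
    (u : H01 Ω) :
    ∫ x in Ω, (b x + c) * val u x ^ 2 = (∫ x in Ω, b x * val u x ^ 2) + c * ‖valL u‖ ^ 2 := by
  simp only [add_mul]
  rw [integral_add (integrable_mul_sq hb (memLp_val u)) ((memLp_val u).integrable_sq.const_mul c),
    integral_const_mul, integral_val_sq]

/-- The form `(u, v) ↦ ∫_Ω (ε ∇u · ∇v + b u v)` of the Schrödinger operator `-ε Δ + b`. -/
def schrodingerForm (ε : ℝ) {b : Rn d → ℝ} (hb : MemLp b ∞ (volume.restrict Ω)) :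
    H01 Ω →L[ℝ] H01 Ω →L[ℝ] ℝ :=
  ε • gradForm Ω + potentialForm hb

theorem schrodingerForm_self (ε : ℝ) {b : Rn d → ℝ} (hb : MemLp b ∞ (volume.restrict Ω))
    (u : H01 Ω) :
    schrodingerForm ε hb u u = ε * ‖gradL u‖ ^ 2 + ∫ x in Ω, b x * val u x ^ 2 := by
  rw [← gradForm_self, ← potentialForm_self hb]
  rfl

theorem exists_norm_valL_sq_le (hd1 : 1 ≤ d) (hd4 : d ≤ 4) (hΩb : Bornology.IsBounded Ω)
    {b : Rn d → ℝ} (hb : MemLp b ∞ (volume.restrict Ω))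
    (hpos : ∀ᵐ x ∂(volume.restrict Ω), 0 < b x) {δ : ℝ} (hδ : 0 < δ) :
    ∃ n > 0, ∀ u : H01 Ω,
      ‖valL u‖ ^ 2 ≤ n * (∫ x in Ω, b x * val u x ^ 2) + δ * ‖gradL u‖ ^ 2 := by
  have : IsFiniteMeasure (volume.restrict Ω) := isFiniteMeasure_restrict.2 hΩb.measure_lt_top.ne
  obtain ⟨J, hJ⟩ := exists_clm_four_ae_eq_val hd1 hd4 hΩb
  obtain ⟨C, hC, hCu⟩ := exists_norm_le_mul_norm_gradL hd1 hd4 hΩb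
  have hJu (u : H01 Ω) : ‖J u‖ ≤ (‖J‖ * C + 1) * ‖gradL u‖ :=
    calc ‖J u‖ ≤ ‖J‖ * (C * ‖gradL u‖) := J.le_opNorm_of_le (hCu u)
      _ ≤ (‖J‖ * C + 1) * ‖gradL u‖ := by linarith [norm_nonneg (gradL u)]
  obtain ⟨n, hn, hnJ⟩ := exists_integral_sq_le_of_ae_pos hb hpos
    (δ := δ / (‖J‖ * C + 1) ^ 2) (by positivity)
  refine ⟨n, hn, fun u => ?_⟩
  have hsq : ∫ x in Ω, J u x ^ 2 = ‖valL u‖ ^ 2 := by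
    rw [← integral_val_sq]
    exact integral_congr_ae ((hJ u).mono fun x hx => by simp only [hx])
  have hbsq : ∫ x in Ω, b x * J u x ^ 2 = ∫ x in Ω, b x * val u x ^ 2 :=
    integral_congr_ae ((hJ u).mono fun x hx => by simp only [hx])
  calc ‖valL u‖ ^ 2
      ≤ n * (∫ x in Ω, b x * val u x ^ 2) + δ / (‖J‖ * C + 1) ^ 2 * ‖J u‖ ^ 2 := by
        rw [← hsq, ← hbsq]
        exact hnJ (J u)
    _ ≤ n * (∫ x in Ω, b x * val u x ^ 2) + δ / (‖J‖ * C + 1) ^ 2 *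
          ((‖J‖ * C + 1) * ‖gradL u‖) ^ 2 := by
        gcongr
        exact hJu u
    _ = n * (∫ x in Ω, b x * val u x ^ 2) + δ * ‖gradL u‖ ^ 2 := by
        rw [mul_pow, ← mul_assoc, div_mul_cancel₀ δ (by positivity)]

theorem isCoercive_schrodingerForm (hd1 : 1 ≤ d) (hd4 : d ≤ 4) (hΩb : Bornology.IsBounded Ω)
    {ε : ℝ} (hε : 0 < ε) {b : Rn d → ℝ} (hb : MemLp b ∞ (volume.restrict Ω))
    (hbl : ∀ᵐ x ∂(volume.restrict Ω), -(ε * lambda1 Ω) < b x) :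
    IsCoercive (schrodingerForm ε hb) := by
  have : IsFiniteMeasure (volume.restrict Ω) := isFiniteMeasure_restrict.2 hΩb.measure_lt_top.ne
  have hl : 0 < lambda1 Ω + 1 := add_pos_of_nonneg_of_pos lambda1_nonneg one_pos
  have hpos : ∀ᵐ x ∂(volume.restrict Ω), 0 < b x + ε * lambda1 Ω :=
    hbl.mono fun x hx => neg_lt_iff_pos_add.1 hx
  obtain ⟨n, hn, hnu⟩ := exists_norm_valL_sq_le hd1 hd4 hΩb (hb.add (memLp_const (ε * lambda1 Ω)))
    hpos (one_div_pos.2 (mul_pos two_pos hl))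
  obtain ⟨τ, hτ, hτε, hτn⟩ : ∃ τ > 0, τ ≤ ε ∧ τ * n * (lambda1 Ω + 1) ≤ 1 := by
    refine ⟨min ε (1 / (n * (lambda1 Ω + 1))), by positivity, min_le_left _ _, ?_⟩
    rw [mul_assoc, ← le_div_iff₀ (by positivity)]
    exact min_le_right _ _
  refine isCoercive_of_mul_le (isCoercive_gradForm hd1 hd4 hΩb) (half_pos hτ) fun u => ?_
  have hnonneg : 0 ≤ ∫ x in Ω, (b x + ε * lambda1 Ω) * val u x ^ 2 :=
    integral_nonneg_of_ae (hpos.mono fun x hx => mul_nonneg hx.le (sq_nonneg _))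
  calc τ / 2 * gradForm Ω u u = τ / 2 * ‖gradL u‖ ^ 2 := by rw [gradForm_self]
    _ ≤ ε * (‖gradL u‖ ^ 2 - lambda1 Ω * ‖valL u‖ ^ 2) +
          ∫ x in Ω, (b x + ε * lambda1 Ω) * val u x ^ 2 :=
        half_mul_le_of_le_add lambda1_nonneg (sq_nonneg _) (lambda1_mul_norm_valL_sq_le u) hnonneg
          hτ.le hτε hτn ((hnu u).trans_eq (congrArg _ (one_div_mul_eq_div _ _)))
    _ = schrodingerForm ε hb u u := by
        rw [integral_add_const_mul_val_sq hb, schrodingerForm_self]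
        ring

end Dirichlet

section Copositive

variable {ι : Type*} [Fintype ι] {g : Matrix ι ι ℝ}

/-- Strict copositivity of `g`: the quadratic form of `g` is positive on the nonzero vectors with
nonnegative entries. This is the common feature of matrices with positive entries and of positive
definite ones, and it is all that matters for `I`, where `g` acts on the vector of the `uᵢ²`. -/
def StrictlyCopositive (g : Matrix ι ι ℝ) : Prop :=
  ∀ y : ι → ℝ, 0 ≤ y → y ≠ 0 → 0 < y ⬝ᵥ g.mulVec y

theorem strictlyCopositive_of_forall_pos (hg : ∀ i j, 0 < g i j) : StrictlyCopositive g := by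
  intro y hy hy0
  obtain ⟨k, hk⟩ := Function.ne_iff.1 hy0
  have hmul (i : ι) : 0 ≤ g.mulVec y i :=
    Finset.sum_nonneg fun j _ => mul_nonneg (hg i j).le (hy j)
  have hmulk : 0 < g.mulVec y k := Finset.sum_pos' (fun j _ => mul_nonneg (hg k j).le (hy j))
    ⟨k, Finset.mem_univ k, mul_pos (hg k k) ((hy k).lt_of_ne' hk)⟩
  exact Finset.sum_pos' (fun i _ => mul_nonneg (hy i) (hmul i))
    ⟨k, Finset.mem_univ k, mul_pos ((hy k).lt_of_ne' hk) hmulk⟩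

theorem strictlyCopositive_of_posDef (hg : g.PosDef) : StrictlyCopositive g := fun y _ hy0 => by
  simpa only [star_trivial] using hg.dotProduct_mulVec_pos hy0

theorem StrictlyCopositive.exists_pos_forall_mul_norm_sq_le (hg : StrictlyCopositive g) :
    ∃ c > 0, ∀ y : ι → ℝ, 0 ≤ y → c * ‖y‖ ^ 2 ≤ y ⬝ᵥ g.mulVec y := by
  have hcompact : IsCompact (Metric.sphere (0 : ι → ℝ) 1 ∩ Ici 0) :=
    (isCompact_sphere 0 1).inter_right isClosed_Ici
  have hcont : Continuous fun y : ι → ℝ => y ⬝ᵥ g.mulVec y := by fun_prop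
  obtain ⟨c, hc, hcg⟩ := hcompact.exists_forall_le' hcont.continuousOn fun y hy =>
    hg y hy.2 (ne_zero_of_mem_unit_sphere ⟨y, hy.1⟩)
  refine ⟨c, hc, fun y hy => ?_⟩
  rcases eq_or_ne y 0 with rfl | hy0
  · simp
  have hnorm : 0 < ‖y‖ := norm_pos_iff.2 hy0
  have hunit := hcg (‖y‖⁻¹ • y) ⟨by simp [norm_smul, hnorm.ne'], smul_nonneg (by positivity) hy⟩
  rw [Matrix.mulVec_smul, smul_dotProduct, dotProduct_smul, smul_smul, smul_eq_mul, ← sq,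
    inv_pow, ← div_eq_inv_mul, le_div_iff₀ (by positivity)] at hunit
  exact hunit

end Copositive

section MatrixForm

variable {ι : Type*} [Fintype ι] {F : Type*} [NormedAddCommGroup F] [InnerProductSpace ℝ F]

variable (F) in
/-- The form `(y, z) ↦ ∑ᵢⱼ gᵢⱼ ⟪yᵢ, zⱼ⟫` on a finite power of an inner product space. -/
def matrixForm (g : Matrix ι ι ℝ) : (ι → F) →L[ℝ] (ι → F) →L[ℝ] ℝ :=
  ∑ i, ∑ j, g i j •
    (innerSL ℝ).bilinearComp (ContinuousLinearMap.proj i) (ContinuousLinearMap.proj j)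

theorem matrixForm_apply (g : Matrix ι ι ℝ) (y z : ι → F) :
    matrixForm F g y z = ∑ i, ∑ j, g i j * inner ℝ (y i) (z j) := by
  simp only [matrixForm, _root_.sum_apply, _root_.smul_apply, smul_eq_mul,
    ContinuousLinearMap.bilinearComp_apply, ContinuousLinearMap.proj_apply, innerSL_apply_apply]

variable {α : Type*} [MeasurableSpace α] {μ : Measure α}

theorem integrable_sum_sum_mul_mul (g : Matrix ι ι ℝ) (y : ι → Lp ℝ 2 μ) :
    Integrable (fun x => ∑ i, ∑ j, g i j * (y i x * y j x)) μ :=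
  integrable_finsetSum _ fun i _ => integrable_finsetSum _ fun j _ =>
    ((Lp.memLp (y i)).integrable_mul (Lp.memLp (y j))).const_mul _

theorem matrixForm_self_eq_integral (g : Matrix ι ι ℝ) (y : ι → Lp ℝ 2 μ) :
    matrixForm (Lp ℝ 2 μ) g y y = ∫ x, ∑ i, ∑ j, g i j * (y i x * y j x) ∂μ := by
  have hint (i j : ι) : Integrable (fun x => g i j * (y i x * y j x)) μ :=
    ((Lp.memLp (y i)).integrable_mul (Lp.memLp (y j))).const_mul _
  rw [matrixForm_apply, integral_finsetSum _ fun i _ => integrable_finsetSum _ fun j _ => hint i j]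
  refine Finset.sum_congr rfl fun i _ => ?_
  rw [integral_finsetSum _ fun j _ => hint i j]
  refine Finset.sum_congr rfl fun j _ => ?_
  rw [integral_const_mul, L2.inner_def]
  simp only [RCLike.inner_apply, conj_trivial, mul_comm]

theorem mul_norm_sq_le_matrixForm {g : Matrix ι ι ℝ} {c : ℝ} (hc : 0 < c)
    (hg : ∀ y : ι → ℝ, 0 ≤ y → c * ‖y‖ ^ 2 ≤ y ⬝ᵥ g.mulVec y) {y : ι → Lp ℝ 2 μ}
    (hy : ∀ i, 0 ≤ᵐ[μ] y i) : c * ‖y‖ ^ 2 ≤ matrixForm (Lp ℝ 2 μ) g y y := by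
  have hpointwise : ∀ᵐ x ∂μ, c * ‖fun i => y i x‖ ^ 2 ≤ ∑ i, ∑ j, g i j * (y i x * y j x) := by
    filter_upwards [eventually_all.2 hy] with x hx
    refine (hg (fun i => y i x) hx).trans_eq (Finset.sum_congr rfl fun i _ => ?_)
    rw [Matrix.mulVec, dotProduct, Finset.mul_sum]
    exact Finset.sum_congr rfl fun j _ => mul_left_comm _ _ _
  have hnonneg : 0 ≤ matrixForm (Lp ℝ 2 μ) g y y := by
    rw [matrixForm_self_eq_integral]
    exact integral_nonneg_of_ae (hpointwise.mono fun x hx => (by positivity : 0 ≤ c * _).trans hx)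
  rw [← le_div_iff₀' hc]
  refine pi_norm_sq_le (by positivity) fun i => ?_
  rw [le_div_iff₀' hc, matrixForm_self_eq_integral, ← real_inner_self_eq_norm_sq, L2.inner_def,
    ← integral_const_mul]
  refine integral_mono_ae ((L2.integrable_inner (y i) (y i)).const_mul c)
    (integrable_sum_sum_mul_mul g y) (hpointwise.mono fun x hx => ?_)
  calc c * inner ℝ (y i x) (y i x) = c * ‖y i x‖ ^ 2 := by rw [real_inner_self_eq_norm_sq]
    _ ≤ c * ‖fun i => y i x‖ ^ 2 := by gcongr; exact norm_le_pi_norm (fun i => y i x) i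
    _ ≤ ∑ i, ∑ j, g i j * (y i x * y j x) := hx

variable (ι μ) in
/-- Componentwise multiplication as a bounded bilinear map `(L⁴)^ι × (L⁴)^ι → (L²)^ι`. -/
def piMulL4 : (ι → Lp ℝ 4 μ) →L[ℝ] (ι → Lp ℝ 4 μ) →L[ℝ] (ι → Lp ℝ 2 μ) :=
  LinearMap.mkContinuous₂
    (LinearMap.mk₂ ℝ (fun x y i => mulL4 μ (x i) (y i))
      (fun _ _ _ => funext fun _ => by simp) (fun _ _ _ => funext fun _ => by simp)
      (fun _ _ _ => funext fun _ => by simp) (fun _ _ _ => funext fun _ => by simp)) 1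
    fun x y => (pi_norm_le_iff_of_nonneg (by positivity)).2 fun i =>
      (norm_mulL4_le (x i) (y i)).trans <| by
        rw [one_mul]
        exact mul_le_mul (norm_le_pi_norm x i) (norm_le_pi_norm y i) (norm_nonneg _) (norm_nonneg _)

theorem piMulL4_apply (x y : ι → Lp ℝ 4 μ) (i : ι) : piMulL4 ι μ x y i = mulL4 μ (x i) (y i) :=
  rfl

theorem norm_sq_le_norm_piMulL4_self (x : ι → Lp ℝ 4 μ) : ‖x‖ ^ 2 ≤ ‖piMulL4 ι μ x x‖ :=
  pi_norm_sq_le (norm_nonneg _) fun i => by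
    rw [← norm_mulL4_self]
    exact norm_le_pi_norm (piMulL4 ι μ x x) i

variable (μ) in
theorem StrictlyCopositive.exists_pos_forall_mul_norm_pow_four_le {g : Matrix ι ι ℝ}
    (hg : StrictlyCopositive g) :
    ∃ c > 0, ∀ x, c * ‖x‖ ^ 4 ≤ quartic (piMulL4 ι μ) (matrixForm (Lp ℝ 2 μ) g) x := by
  obtain ⟨c, hc, hcg⟩ := hg.exists_pos_forall_mul_norm_sq_le
  refine ⟨c, hc, fun x => ?_⟩
  have hsq (i : ι) : 0 ≤ᵐ[μ] piMulL4 ι μ x x i :=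
    (coeFn_mulL4 (x i) (x i)).mono fun a ha => (mul_self_nonneg (x i a)).trans_eq ha.symm
  calc c * ‖x‖ ^ 4 = c * (‖x‖ ^ 2) ^ 2 := by ring
    _ ≤ c * ‖piMulL4 ι μ x x‖ ^ 2 := by gcongr; exact norm_sq_le_norm_piMulL4_self x
    _ ≤ quartic (piMulL4 ι μ) (matrixForm (Lp ℝ 2 μ) g) x := mul_norm_sq_le_matrixForm hc hcg hsq

theorem quartic_matrixForm_eq_integral (g : Matrix ι ι ℝ) (x : ι → Lp ℝ 4 μ) :
    quartic (piMulL4 ι μ) (matrixForm (Lp ℝ 2 μ) g) x =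
      ∫ a, ∑ i, ∑ j, g i j * x i a ^ 2 * x j a ^ 2 ∂μ := by
  rw [quartic, matrixForm_self_eq_integral]
  refine integral_congr_ae ?_
  filter_upwards [eventually_all.2 fun i => coeFn_mulL4 (x i) (x i)] with a ha
  simp only [piMulL4_apply, ha, sq, mul_assoc]

end MatrixForm

section Functional

variable {d m : ℕ} {Ω : Set (Rn d)}

/-- The form of which `K ε a` is the quadratic form. -/
def formK (ε : Fin m → ℝ) {a : Fin m → Rn d → ℝ} (ha : ∀ i, MemLp (a i) ∞ (volume.restrict Ω)) :
    HSpace Ω m →L[ℝ] HSpace Ω m →L[ℝ] ℝ :=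
  diagForm fun i => schrodingerForm (ε i) (ha i)

theorem formK_self (ε : Fin m → ℝ) {a : Fin m → Rn d → ℝ}
    (ha : ∀ i, MemLp (a i) ∞ (volume.restrict Ω)) (u : HSpace Ω m) :
    formK ε ha u u = ∑ i, schrodingerForm (ε i) (ha i) (u i) (u i) :=
  diagForm_apply _ u u

theorem K_eq_formK (ε : Fin m → ℝ) {a : Fin m → Rn d → ℝ}
    (ha : ∀ i, MemLp (a i) ∞ (volume.restrict Ω)) (u : HSpace Ω m) :
    K ε a u = formK ε ha u u := by
  have hgrad (i : Fin m) : Integrable (fun x => ε i * ‖grad (u i) x‖ ^ 2) (volume.restrict Ω) :=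
    ((memLp_grad (u i)).integrable_norm_pow two_ne_zero).const_mul _
  have hval (i : Fin m) := integrable_mul_sq (ha i) (memLp_val (u i))
  have hint (i : Fin m) : Integrable (fun x => ε i * ‖grad (u i) x‖ ^ 2 + a i x * val (u i) x ^ 2)
      (volume.restrict Ω) := (hgrad i).add (hval i)
  rw [formK_self, K, integral_finsetSum _ fun i _ => hint i]
  refine Finset.sum_congr rfl fun i _ => ?_
  rw [integral_add (hgrad i) (hval i), integral_const_mul, integral_grad_sq, schrodingerForm_self]

variable (Ω) in
/-- The form of which `hNorm ε` is the norm. -/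
def hForm (ε : Fin m → ℝ) : HSpace Ω m →L[ℝ] HSpace Ω m →L[ℝ] ℝ :=
  formK ε fun _ => MemLp.zero (p := ∞) (μ := volume.restrict Ω)

theorem hNorm_eq_sqrt_hForm (ε : Fin m → ℝ) (u : HSpace Ω m) :
    hNorm ε u = √(hForm Ω ε u u) := by
  rw [hForm, ← K_eq_formK, hNorm, K]
  simp only [Pi.zero_apply, zero_mul, add_zero]

theorem hNorm_sub_comm (ε : Fin m → ℝ) (u v : HSpace Ω m) :
    hNorm ε (u - v) = hNorm ε (v - u) := by
  rw [hNorm_eq_sqrt_hForm, hNorm_eq_sqrt_hForm, apply_sub_self_comm (hForm Ω ε) u v]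

theorem hDist_le_of_mem {ε : Fin m → ℝ} {S : Set (HSpace Ω m)} {w : HSpace Ω m} (hw : w ∈ S)
    (v : HSpace Ω m) : hDist ε v S ≤ hNorm ε (w - v) := by
  refine csInf_le ⟨0, ?_⟩ ⟨w, hw, hNorm_sub_comm ε v w⟩
  rintro r ⟨s, -, rfl⟩
  exact Real.sqrt_nonneg _

theorem isCoercive_hForm (hd1 : 1 ≤ d) (hd4 : d ≤ 4) (hΩb : Bornology.IsBounded Ω)
    {ε : Fin m → ℝ} (hε : ∀ i, 0 < ε i) : IsCoercive (hForm Ω ε) := by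
  refine isCoercive_diagForm fun i =>
    isCoercive_of_mul_le (isCoercive_gradForm hd1 hd4 hΩb) (hε i) fun u => ?_
  simp only [schrodingerForm_self, gradForm_self, Pi.zero_apply, zero_mul, integral_zero, add_zero,
    le_refl]

theorem isCoercive_formK (hd1 : 1 ≤ d) (hd4 : d ≤ 4) (hΩb : Bornology.IsBounded Ω)
    {ε : Fin m → ℝ} (hε : ∀ i, 0 < ε i) {a : Fin m → Rn d → ℝ}
    (ha : ∀ i, MemLp (a i) ∞ (volume.restrict Ω))
    (hal : ∀ i, ∀ᵐ x ∂(volume.restrict Ω), -(ε i * lambda1 Ω) < a i x) :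
    IsCoercive (formK ε ha) :=
  isCoercive_diagForm fun i => isCoercive_schrodingerForm hd1 hd4 hΩb (hε i) (ha i) (hal i)

theorem K_smul (ε : Fin m → ℝ) {a : Fin m → Rn d → ℝ}
    (ha : ∀ i, MemLp (a i) ∞ (volume.restrict Ω)) (s : ℝ) (u : HSpace Ω m) :
    K ε a (s • u) = s ^ 2 * K ε a u := by
  rw [K_eq_formK ε ha, K_eq_formK ε ha, apply_smul_self]

theorem differentiable_K (ε : Fin m → ℝ) {a : Fin m → Rn d → ℝ}
    (ha : ∀ i, MemLp (a i) ∞ (volume.restrict Ω)) :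
    Differentiable ℝ (K ε a : HSpace Ω m → ℝ) := by
  rw [funext (K_eq_formK ε ha)]
  exact differentiable_apply_self (formK ε ha)

theorem exists_I_eq_quartic (hd1 : 1 ≤ d) (hd4 : d ≤ 4) (hΩb : Bornology.IsBounded Ω)
    (g : Matrix (Fin m) (Fin m) ℝ) :
    ∃ j : HSpace Ω m →L[ℝ] Fin m → Lp ℝ 4 (volume.restrict Ω), Function.Injective j ∧
      ∀ u, I g u = quartic (piMulL4 (Fin m) (volume.restrict Ω)) (matrixForm _ g) (j u) := by
  obtain ⟨J, hJ⟩ := exists_clm_four_ae_eq_val hd1 hd4 hΩb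
  have hJinj : Function.Injective J := (injective_iff_map_eq_zero J).2 fun u hu =>
    eq_zero_of_val_ae_eq_zero ((hJ u).symm.trans (hu ▸ Lp.coeFn_zero _ _ _))
  refine ⟨ContinuousLinearMap.piMap fun _ => J, fun u v huv =>
    funext fun i => hJinj (congrFun huv i), fun u => ?_⟩
  rw [quartic_matrixForm_eq_integral]
  refine integral_congr_ae ?_
  filter_upwards [eventually_all.2 fun i => hJ (u i)] with x hx
  simp only [ContinuousLinearMap.coe_piMap', Pi.map_apply, hx]

theorem I_smul (hd1 : 1 ≤ d) (hd4 : d ≤ 4) (hΩb : Bornology.IsBounded Ω)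
    (g : Matrix (Fin m) (Fin m) ℝ) (s : ℝ) (u : HSpace Ω m) : I g (s • u) = s ^ 4 * I g u := by
  obtain ⟨j, -, hI⟩ := exists_I_eq_quartic hd1 hd4 hΩb g
  rw [hI, hI, map_smul, quartic_smul]

theorem differentiable_I (hd1 : 1 ≤ d) (hd4 : d ≤ 4) (hΩb : Bornology.IsBounded Ω)
    (g : Matrix (Fin m) (Fin m) ℝ) : Differentiable ℝ (I g : HSpace Ω m → ℝ) := by
  obtain ⟨j, -, hI⟩ := exists_I_eq_quartic hd1 hd4 hΩb g
  rw [funext hI]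
  exact (differentiable_quartic _ _).comp j.differentiable

theorem I_pos (hd1 : 1 ≤ d) (hd4 : d ≤ 4) (hΩb : Bornology.IsBounded Ω)
    {g : Matrix (Fin m) (Fin m) ℝ} (hg : StrictlyCopositive g) {u : HSpace Ω m} (hu : u ≠ 0) :
    0 < I g u := by
  obtain ⟨j, hj, hI⟩ := exists_I_eq_quartic hd1 hd4 hΩb g
  obtain ⟨c, hc, hcg⟩ := hg.exists_pos_forall_mul_norm_pow_four_le (volume.restrict Ω)
  have : 0 < ‖j u‖ := norm_pos_iff.2 ((map_ne_zero_iff j hj).2 hu)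
  rw [hI]
  exact (by positivity : 0 < c * ‖j u‖ ^ 4).trans_le (hcg (j u))

variable {ε : Fin m → ℝ} {a : Fin m → Rn d → ℝ} {g : Matrix (Fin m) (Fin m) ℝ}

theorem fderiv_E_self (hd1 : 1 ≤ d) (hd4 : d ≤ 4) (hΩb : Bornology.IsBounded Ω)
    (ha : ∀ i, MemLp (a i) ∞ (volume.restrict Ω)) (u : HSpace Ω m) :
    fderiv ℝ (E ε a g) u u = K ε a u - I g u := by
  have hK := (differentiable_K ε ha u).const_mul (1 / 2)
  have hI := (differentiable_I hd1 hd4 hΩb g u).const_mul (1 / 4)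
  have hKu : fderiv ℝ (fun v => 1 / 2 * K ε a v) u u = (2 : ℕ) * (1 / 2 * K ε a u) :=
    fderiv_apply_self_of_homogeneous (fun s => by rw [K_smul ε ha]; ring) hK
  have hIu : fderiv ℝ (fun v => 1 / 4 * I g v) u u = (4 : ℕ) * (1 / 4 * I g u) :=
    fderiv_apply_self_of_homogeneous (fun s => by rw [I_smul hd1 hd4 hΩb]; ring) hI
  change fderiv ℝ (fun v => 1 / 2 * K ε a v - 1 / 4 * I g v) u u = _
  rw [fderiv_fun_sub hK hI, _root_.sub_apply, hKu, hIu]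
  push_cast
  ring

theorem mem_nehari_iff (hd1 : 1 ≤ d) (hd4 : d ≤ 4) (hΩb : Bornology.IsBounded Ω)
    (ha : ∀ i, MemLp (a i) ∞ (volume.restrict Ω)) {u : HSpace Ω m} :
    u ∈ nehari Ω ε a g ↔ u ≠ 0 ∧ K ε a u = I g u := by
  change _ ∧ _ ↔ _
  rw [fderiv_E_self hd1 hd4 hΩb ha, sub_eq_zero]

variable (hd1 : 1 ≤ d) (hd4 : d ≤ 4) (hΩb : Bornology.IsBounded Ω) (hg : StrictlyCopositive g)
  (ha : ∀ i, MemLp (a i) ∞ (volume.restrict Ω))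

include hd1 hd4 hΩb hg ha

theorem add_smul_sub_ne_zero_of_mem_nehari {u v : HSpace Ω m} (hu : u ∈ nehari Ω ε a g)
    (hv : v ∈ nehari Ω ε a g) {t : ℝ} (ht : 0 ≤ t) : u + t • (u - v) ≠ 0 := by
  rw [mem_nehari_iff hd1 hd4 hΩb ha] at hu hv
  exact add_smul_sub_ne_zero_of_homogeneous (K_smul ε ha) (I_smul hd1 hd4 hΩb g) hu.2 hv.2
    (hu.2 ▸ I_pos hd1 hd4 hΩb hg hu.1) ht

variable (hε : ∀ i, 0 < ε i)
  (hal : ∀ i, ∀ᵐ x ∂(volume.restrict Ω), -(ε i * lambda1 Ω) < a i x)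

include hε hal

theorem rho_smul_mem_nehari {w : HSpace Ω m} (hw : w ≠ 0) :
    rho ε a g w • w ∈ nehari Ω ε a g := by
  have hK : 0 < K ε a w := by
    rw [K_eq_formK ε ha]
    exact apply_self_pos_of_isCoercive (isCoercive_formK hd1 hd4 hΩb hε ha hal) hw
  have hI : 0 < I g w := I_pos hd1 hd4 hΩb hg hw
  have hρ : rho ε a g w ≠ 0 := (Real.sqrt_pos.2 (div_pos hK hI)).ne'
  exact (mem_nehari_iff hd1 hd4 hΩb ha).2 ⟨smul_ne_zero hρ hw,
    balanced_sqrt_div_smul (K_smul ε ha) (I_smul hd1 hd4 hΩb g) hK.le hI⟩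

theorem exists_hNorm_rho_smul_sub_le :
    ∃ A > 0, ∃ δ > 0, ∀ u ∈ nehari Ω ε a g, ∀ v ∈ nehari Ω ε a g, hNorm ε (u - v) < δ →
      ∀ t ∈ Icc (0 : ℝ) 1, ∀ w, w = u + t • (u - v) →
        hNorm ε (rho ε a g w • w - w) ≤ A * hNorm ε (u - v) ^ 2 := by
  obtain ⟨j, -, hI⟩ := exists_I_eq_quartic hd1 hd4 hΩb g
  obtain ⟨b, hb, hbg⟩ := hg.exists_pos_forall_mul_norm_pow_four_le (volume.restrict Ω)
  obtain ⟨c, hc, hcH⟩ := exists_mul_norm_le_sqrt_apply_self (isCoercive_hForm hd1 hd4 hΩb hε)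
  obtain ⟨A, hA, δ, hδ, hbound⟩ := exists_norm_sqrt_div_quartic_smul_sub_le
    (isCoercive_formK hd1 hd4 hΩb hε ha hal) hb fun v => hbg (j v)
  simp only [← hNorm_eq_sqrt_hForm, ← le_div_iff₀' hc] at hcH
  simp only [← hI, ← K_eq_formK ε ha] at hbound
  refine ⟨(√‖hForm Ω ε‖ + 1) * A / c ^ 2, by positivity, c * δ, by positivity, ?_⟩
  intro u hu v hv huv t ht w hw
  rw [mem_nehari_iff hd1 hd4 hΩb ha] at hu hv
  have hclose : ‖u - v‖ < δ := (hcH _).trans_lt ((div_lt_iff₀' hc).2 huv)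
  calc hNorm ε (rho ε a g w • w - w) ≤ √‖hForm Ω ε‖ * ‖rho ε a g w • w - w‖ := by
        rw [hNorm_eq_sqrt_hForm]
        exact sqrt_apply_self_le _ _
    _ ≤ (√‖hForm Ω ε‖ + 1) * (A * (hNorm ε (u - v) / c) ^ 2) := by
        gcongr
        · exact le_add_of_nonneg_right zero_le_one
        · exact (hbound u hu.1 v hu.2 hv.2 hclose t ht w hw).trans (by gcongr; exact hcH _)
    _ = (√‖hForm Ω ε‖ + 1) * A / c ^ 2 * hNorm ε (u - v) ^ 2 := by ring

end Functional

end Nehari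

end

theorem lemma3p1_general {d m : ℕ} (hd1 : 1 ≤ d) (hd4 : d ≤ 4)
    (Ω : Set (EuclideanSpace ℝ (Fin d))) (hΩb : Bornology.IsBounded Ω)
    (ε : Fin m → ℝ) (hε : ∀ i, 0 < ε i)
    (g : Matrix (Fin m) (Fin m) ℝ) (hg : Nehari.StrictlyCopositive g)
    (a : Fin m → EuclideanSpace ℝ (Fin d) → ℝ)
    (ha : ∀ i, MemLp (a i) ∞ (volume.restrict Ω))
    (hal : ∀ i, ∀ᵐ x ∂(volume.restrict Ω), -(ε i * Nehari.lambda1 Ω) < a i x) :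
    (∀ u ∈ Nehari.nehari Ω ε a g, ∀ ubar ∈ Nehari.nehari Ω ε a g, ∀ t : ℝ, 0 ≤ t →
      ∀ what w : Nehari.HSpace Ω m,
      what = u + t • (u - ubar) → w = Nehari.rho ε a g what • what →
        what ≠ 0 ∧ w ∈ Nehari.nehari Ω ε a g ∧
        Nehari.hDist ε what (Nehari.nehari Ω ε a g) ≤ Nehari.hNorm ε (w - what)) ∧
    (∀ η : ℝ, 0 < η → ∃ δ : ℝ, 0 < δ ∧
      ∀ u ∈ Nehari.nehari Ω ε a g, ∀ ubar ∈ Nehari.nehari Ω ε a g, ∀ t ∈ Set.Icc (0 : ℝ) 1,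
      ∀ what w : Nehari.HSpace Ω m,
      what = u + t • (u - ubar) → w = Nehari.rho ε a g what • what →
        Nehari.hNorm ε (u - ubar) < δ →
          Nehari.hNorm ε (w - what) ≤ η * Nehari.hNorm ε (u - ubar)) := by
  refine ⟨?_, fun η hη => ?_⟩
  · rintro u hu ubar hubar t ht what w rfl rfl
    have hne := Nehari.add_smul_sub_ne_zero_of_mem_nehari hd1 hd4 hΩb hg ha hu hubar ht
    have hmem := Nehari.rho_smul_mem_nehari hd1 hd4 hΩb hg ha hε hal hne
    exact ⟨hne, hmem, Nehari.hDist_le_of_mem hmem _⟩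
  · obtain ⟨A, hA, δ, hδ, hquad⟩ :=
      Nehari.exists_hNorm_rho_smul_sub_le hd1 hd4 hΩb hg ha hε hal
    refine ⟨min δ (η / A), by positivity, ?_⟩
    rintro u hu ubar hubar t ht what w hwhat rfl hclose
    obtain ⟨hδ', hη'⟩ := lt_min_iff.1 hclose
    calc Nehari.hNorm ε (Nehari.rho ε a g what • what - what)
        ≤ A * Nehari.hNorm ε (u - ubar) ^ 2 := hquad u hu ubar hubar hδ' t ht what hwhat
      _ = A * Nehari.hNorm ε (u - ubar) * Nehari.hNorm ε (u - ubar) := by ring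
      _ ≤ η * Nehari.hNorm ε (u - ubar) := by
          gcongr
          · exact Real.sqrt_nonneg _
          · exact ((lt_div_iff₀' hA).1 hη').le

theorem lemma3p1 {d m : ℕ} (hd1 : 1 ≤ d) (hd4 : d ≤ 4)
    (Ω : Set (EuclideanSpace ℝ (Fin d))) (hΩo : IsOpen Ω) (hΩc : IsConnected Ω)
    (hΩb : Bornology.IsBounded Ω)
    (ε : Fin m → ℝ) (hε : ∀ i, 0 < ε i)
    (g : Matrix (Fin m) (Fin m) ℝ) (hgs : g.IsSymm)
    (hg : (∀ i j, 0 < g i j) ∨ g.PosDef)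
    (a : Fin m → EuclideanSpace ℝ (Fin d) → ℝ)
    (ha : ∀ i, MemLp (a i) ∞ (volume.restrict Ω))
    (hal : ∀ i, ∀ᵐ x ∂(volume.restrict Ω), -(ε i * Nehari.lambda1 Ω) < a i x) :
    (∀ u ∈ Nehari.nehari Ω ε a g, ∀ ubar ∈ Nehari.nehari Ω ε a g, ∀ t ∈ Set.Icc (0 : ℝ) 1,
      ∀ what w : Nehari.HSpace Ω m,
      what = u + t • (u - ubar) → w = Nehari.rho ε a g what • what →
        what ≠ 0 ∧ w ∈ Nehari.nehari Ω ε a g ∧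
        Nehari.hDist ε what (Nehari.nehari Ω ε a g) ≤ Nehari.hNorm ε (w - what)) ∧
    (∀ η : ℝ, 0 < η → ∃ δ : ℝ, 0 < δ ∧
      ∀ u ∈ Nehari.nehari Ω ε a g, ∀ ubar ∈ Nehari.nehari Ω ε a g, ∀ t ∈ Set.Icc (0 : ℝ) 1,
      ∀ what w : Nehari.HSpace Ω m,
      what = u + t • (u - ubar) → w = Nehari.rho ε a g what • what →
        Nehari.hNorm ε (u - ubar) < δ →
          Nehari.hNorm ε (w - what) ≤ η * Nehari.hNorm ε (u - ubar)) :=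
  (lemma3p1_general hd1 hd4 Ω hΩb ε hε g
    (hg.elim Nehari.strictlyCopositive_of_forall_pos Nehari.strictlyCopositive_of_posDef) a ha
    hal).imp_left fun h u hu ubar hubar t ht => h u hu ubar hubar t ht.1
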